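/- Let $d\in\mathbb N_0$ and let $\mathcal L\subset\mathbb R^d$ be countable, and suppose that for some $\gamma>0$ there are $C,r_0\ge 0$ with $|B_r(z)\cap\mathcal L|\le C r^\gamma$ for all $r\ge r_0$ and $z\in\mathcal L$, where $B_r(z)$ is the open Euclidean ball. To each $x\in\mathcal L$ associate a nonzero finite-dimensional complex Hilbert space $\mathcal H_x$. For finite $\Lambda\subset\mathcal L$ let $\mathcal U_\Lambda=L(\bigotimes_{x\in\Lambda}\mathcal H_x)$, with the natural inclusions $A\mapsto A\otimes\mathbb I$, let $\mathcal U_{\rm loc}=\bigcup_\Lambda\mathcal U_\Lambda$, and let $\mathcal U$ be the norm completion of $\mathcal U_{\rm loc}$; the support $\mathrm{supp}(A)$ of $A\in\mathcal U_{\rm loc}$ is the smallest $\Lambda$ with $A\in\mathcal U_\Lambda$. Let $P_0(\mathcal L)$ be the set of nonempty finite subsets of $\mathcal L$. Let $n_x\in\mathcal U_{\rm loc}$ $(x\in\mathcal L)$ be self-adjoint and pairwise commuting, with $\sup_x\|n_x\|<\infty$ and $\mathrm{supp}(n_x)\subseteq B_{R_0}(x)$ for some $R_0>0$ independent of $x$.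 For $a\in\mathbb N_0^d$ put $|a|=\sum_j a_j$, $x^a=\prod_j x_j^{a_j}$ and, for $s\in\mathbb R$ and $A\in\mathcal U_\Lambda$, $$\tau^{(a)}_s(A)=\exp\Bigl(-is\sum_{x:\,\mathrm{supp}(n_x)\cap\Lambda\neq\emptyset}x^an_x\Bigr)\,A\,\exp\Bigl(is\sum_{x:\,\mathrm{supp}(n_x)\cap\Lambda\neq\emptyset}x^an_x\Bigr).$$ Let $k\in\mathbb N_0$ and let $(\phi(\Lambda))_{\Lambda\in P_0(\mathcal L)}$ be an interaction, i.e. $\phi(\Lambda)=\phi(\Lambda)^*\in\mathcal U_\Lambda$, such that $$\sup_{x\in\mathcal L}\ \sum_{\Lambda\ni x}\|\phi(\Lambda)\|\Bigl(\sum_{z:\,\mathrm{supp}(n_z)\cap\Lambda\ne\emptyset}|z-x|^{k+1}\Bigr)^2<\infty$$ and, for some $\varepsilon>0$, $$\sup_{x,y\in\mathcal L}(1+|x-y|)^{\gamma+1+\varepsilon}\sum_{\Lambda\ni x,y}\|\phi(\Lambda)\|<\infty .$$ Let $\tilde\chi\in C_c^\infty(\mathbb R)$ with $0\le\tilde\chi\le1$,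 $\tilde\chi(u)=1$ for $|u|\le1$ and $\tilde\chi(u)=0$ for $|u|\ge2$. For $m\in\mathbb N=\{1,2,\dots\}$ set $\chi_m(x)=\prod_{j=1}^d\tilde\chi(x_j/m)$ and $$U_m^{(a)}(s)=\exp\Bigl(is\sum_{x\in\mathcal L}\chi_m(x)\,x^an_x\Bigr).$$ Then the interaction induces a time evolution: there is a strongly continuous one-parameter group $\alpha=(\alpha_t)_{t\in\mathbb R}$ of $*$-automorphisms of $\mathcal U$ such that, with $H_\Lambda=\sum_{\emptyset\neq X\subseteq\Lambda}\phi(X)$, $\alpha_t(A)=\lim_{j\to\infty}e^{itH_{\Lambda_j}}Ae^{-itH_{\Lambda_j}}$ for all $t\in\mathbb R$, all $A\in\mathcal U$ and every increasing sequence of finite sets $\Lambda_j$ with $\bigcup_j\Lambda_j=\mathcal L$. Its infinitesimal generator $\delta$, $\delta(A)=\frac{d}{dt}\alpha_t(A)|_{t=0}$, has the following properties. 1. Suppose that $\tau_s^{(b)}(\phi(\Lambda))=\phi(\Lambda)$ for all $\Lambda\in P_0(\mathcal L)$, all $s\in\mathbb R$ and all $b\in\mathbb N_0^d$ with $|b|\le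 k$. If $|a|\le k$ and $\gamma\le 2(k-|a|+1)$, then for every $s\in\mathbb R$ the operators $U_m=U_m^{(a)}(s)$ and their adjoints lie in the domain of $\delta$, and $$\sup_{m\in\mathbb N}\bigl\|U_m\,\delta(U_m^*)+U_m^*\,\delta(U_m)\bigr\|<\infty .\tag{$*$}$$ 2. Let $I\subseteq\{1,\dots,d\}$ and $M_j\ge0$ $(j\in I)$ be such that $|x_j|\le M_j$ for all $x\in\mathcal L$ and $j\in I$, and put $T_k=\{b\in\mathbb N_0^d:\ |b|\le k,\ b_j=0\text{ for all }j\in I\}$. Suppose that $\tau_s^{(b)}(\phi(\Lambda))=\phi(\Lambda)$ for all $\Lambda\in P_0(\mathcal L)$ and $s\in\mathbb R$, but only for $b\in T_k$. If $a\in T_k$ and $\gamma\le 2(k-|a|+1)$, then for every $s\in\mathbb R$ the operators $U_m=U_m^{(a)}(s)$ and their adjoints lie in the domain of $\delta$, and $(*)$ holds. -/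

import Mathlib

open scoped ENNReal InnerProductSpace

/-! ### Quantum spin systems

`S` is the set of sites and `ι x` labels an orthonormal basis of the one-site Hilbert space
`ℂ^(ι x)`.  For a finite set `Λ` of sites, the tensor product of these spaces over `x ∈ Λ` is
`ℓ²` of the set of configurations on `Λ`.  All the algebras `L(H_Λ)` are represented on `ℓ²` of the
set of configurations on `S`, where an operator on `H_Λ` acts on the configuration inside `Λ`
and leaves the configuration outside `Λ` alone, i.e. as `A ⊗ 𝟙`. -/

section QuasiLocal

variable {S : Type*} (ι : S → Type*)

/-- Configurations on the finite set `Λ`. -/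
def LocalConfig (Λ : Finset S) : Type _ := ∀ x : {x : S // x ∈ Λ}, ι x

/-- Configurations outside `Λ`. -/
def OuterConfig (Λ : Finset S) : Type _ := ∀ x : {x : S // ¬ x ∈ Λ}, ι x

noncomputable instance LocalConfig.instFintype [∀ x, Finite (ι x)] (Λ : Finset S) :
    Fintype (LocalConfig ι Λ) := by
  unfold LocalConfig
  exact Fintype.ofFinite _

/-- The Hilbert space `H_Λ = ⨂_{x ∈ Λ} ℂ^(ι x)`. -/
abbrev LocalHilbert [∀ x, Finite (ι x)] (Λ : Finset S) : Type _ :=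
  EuclideanSpace ℂ (LocalConfig ι Λ)

/-- `ℓ²` of the set of all configurations, on which all local operators act. -/
abbrev ConfigHilbert : Type _ := lp (fun _ : (∀ x, ι x) => ℂ) 2

open scoped Classical in
/-- A configuration is a configuration inside `Λ` together with one outside `Λ`. -/
noncomputable def splitConfig (Λ : Finset S) :
    (∀ x, ι x) ≃ LocalConfig ι Λ × OuterConfig ι Λ :=
  Equiv.piEquivPiSubtypeProd (fun x => x ∈ Λ) ι

variable [∀ x, Finite (ι x)]

/-- The vector of `H_Λ` obtained from `ψ` by freezing the configuration outside `Λ`. -/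
noncomputable def slice (Λ : Finset S) (ψ : (∀ x, ι x) → ℂ) (η : OuterConfig ι Λ) :
    LocalHilbert ι Λ :=
  WithLp.toLp 2 fun τ => ψ ((splitConfig ι Λ).symm (τ, η))

/-- The action of `A ⊗ 𝟙` on functions of the configuration. -/
noncomputable def localAct (Λ : Finset S) (A : LocalHilbert ι Λ →L[ℂ] LocalHilbert ι Λ)
    (ψ : (∀ x, ι x) → ℂ) : (∀ x, ι x) → ℂ :=
  fun σ => A (slice ι Λ ψ (splitConfig ι Λ σ).2) (splitConfig ι Λ σ).1

theorem slice_localAct (Λ : Finset S) (A : LocalHilbert ι Λ →L[ℂ] LocalHilbert ι Λ)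
    (ψ : (∀ x, ι x) → ℂ) (η : OuterConfig ι Λ) :
    slice ι Λ (localAct ι Λ A ψ) η = A (slice ι Λ ψ η) := by
  ext τ
  simp [slice, localAct]

theorem slice_eq_ext (Λ : Finset S) {ψ ψ' : (∀ x, ι x) → ℂ}
    (h : ∀ η, slice ι Λ ψ η = slice ι Λ ψ' η) : ψ = ψ' := by
  funext σ
  have := congrArg (fun v : LocalHilbert ι Λ => v (splitConfig ι Λ σ).1) (h (splitConfig ι Λ σ).2)
  simpa [slice] using this

theorem hasSum_slice (Λ : Finset S) (ψ : ConfigHilbert ι) :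
    HasSum (fun η => ‖slice ι Λ ψ η‖ ^ 2) (‖ψ‖ ^ 2) := by
  have h : HasSum (fun σ => ‖ψ σ‖ ^ 2) (‖ψ‖ ^ 2) := by
    have := lp.hasSum_norm (p := 2) (by norm_num) ψ
    simpa using this
  rw [← (splitConfig ι Λ).symm.hasSum_iff, ← (Equiv.prodComm _ _).hasSum_iff] at h
  refine h.prod_fiberwise fun η => ?_
  have := hasSum_fintype fun τ => ‖ψ ((splitConfig ι Λ).symm (τ, η))‖ ^ 2
  rw [EuclideanSpace.norm_sq_eq]
  simpa [slice] using this

theorem memℓp_of_slice (Λ : Finset S) (ψ : (∀ x, ι x) → ℂ)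
    (h : Summable fun η => ‖slice ι Λ ψ η‖ ^ 2) : Memℓp ψ 2 := by
  refine memℓp_gen ?_
  simp only [ENNReal.toReal_ofNat, Real.rpow_ofNat]
  rw [← (splitConfig ι Λ).symm.summable_iff, ← (Equiv.prodComm _ _).summable_iff]
  refine (summable_prod_of_nonneg (fun _ => sq_nonneg _)).2 ⟨fun η => Summable.of_finite, ?_⟩
  refine h.congr fun η => ?_
  rw [EuclideanSpace.norm_sq_eq, tsum_fintype]
  simp [slice]

theorem hasSum_inner_slice (Λ : Finset S) (φ ψ : ConfigHilbert ι) :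
    HasSum (fun η => ⟪slice ι Λ φ η, slice ι Λ ψ η⟫_ℂ) ⟪φ, ψ⟫_ℂ := by
  have h := lp.hasSum_inner (𝕜 := ℂ) φ ψ
  rw [← (splitConfig ι Λ).symm.hasSum_iff, ← (Equiv.prodComm _ _).hasSum_iff] at h
  refine h.prod_fiberwise fun η => ?_
  rw [PiLp.inner_apply]
  exact hasSum_fintype _

theorem summable_slice_localAct (Λ : Finset S) (A : LocalHilbert ι Λ →L[ℂ] LocalHilbert ι Λ)
    (ψ : ConfigHilbert ι) : Summable fun η => ‖slice ι Λ (localAct ι Λ A ψ) η‖ ^ 2 := by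
  refine Summable.of_nonneg_of_le (fun _ => by positivity) (fun η => ?_)
    ((hasSum_slice ι Λ ψ).summable.mul_left (‖A‖ ^ 2))
  rw [slice_localAct, ← mul_pow]
  gcongr
  exact A.le_opNorm _

/-- The operator `A ⊗ 𝟙`. -/
noncomputable def localOp (Λ : Finset S) (A : LocalHilbert ι Λ →L[ℂ] LocalHilbert ι Λ) :
    ConfigHilbert ι →L[ℂ] ConfigHilbert ι :=
  LinearMap.mkContinuous
    { toFun := fun ψ =>
        ⟨localAct ι Λ A ψ, memℓp_of_slice ι Λ _ (summable_slice_localAct ι Λ A ψ)⟩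
      map_add' := fun φ ψ => by
        ext1
        refine slice_eq_ext ι Λ fun η => ?_
        have e : ∀ f g : (∀ x, ι x) → ℂ, slice ι Λ (f + g) η = slice ι Λ f η + slice ι Λ g η :=
          fun _ _ => rfl
        simp only [lp.coeFn_add, e, slice_localAct, map_add]
      map_smul' := fun c ψ => by
        ext1
        refine slice_eq_ext ι Λ fun η => ?_
        have e : ∀ f : (∀ x, ι x) → ℂ, slice ι Λ (c • f) η = c • slice ι Λ f η :=
          fun _ => rfl
        simp only [lp.coeFn_smul, e, slice_localAct, map_smul, RingHom.id_apply] }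
    ‖A‖ (fun ψ => by
      refine (sq_le_sq₀ (norm_nonneg _) (by positivity)).1 ?_
      rw [mul_pow]
      refine hasSum_le (fun η => ?_) (hasSum_slice ι Λ _) ((hasSum_slice ι Λ ψ).mul_left _)
      rw [← mul_pow]
      gcongr
      refine le_trans (le_of_eq ?_) (A.le_opNorm _)
      rw [← slice_localAct]
      rfl)

theorem slice_localOp (Λ : Finset S) (A : LocalHilbert ι Λ →L[ℂ] LocalHilbert ι Λ)
    (ψ : ConfigHilbert ι) (η : OuterConfig ι Λ) :
    slice ι Λ (localOp ι Λ A ψ) η = A (slice ι Λ ψ η) :=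
  slice_localAct ι Λ A ψ η

theorem localOp_ext (Λ : Finset S) {T T' : ConfigHilbert ι →L[ℂ] ConfigHilbert ι}
    (h : ∀ ψ η, slice ι Λ (T ψ) η = slice ι Λ (T' ψ) η) : T = T' := by
  ext1 ψ
  ext1
  exact slice_eq_ext ι Λ (h ψ)

/-- The representation `A ↦ A ⊗ 𝟙` of `L(H_Λ)`. -/
noncomputable def localEmbed (Λ : Finset S) :
    (LocalHilbert ι Λ →L[ℂ] LocalHilbert ι Λ) →⋆ₐ[ℂ]
      (ConfigHilbert ι →L[ℂ] ConfigHilbert ι) where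
  toFun := localOp ι Λ
  map_one' := localOp_ext ι Λ fun ψ η => by rw [slice_localOp]; rfl
  map_mul' A B := localOp_ext ι Λ fun ψ η => by
    simp only [slice_localOp, mul_apply_eq_comp]
  map_zero' := localOp_ext ι Λ fun ψ η => by rw [slice_localOp]; rfl
  map_add' A B := localOp_ext ι Λ fun ψ η => by
    rw [slice_localOp]
    have : slice ι Λ ((localOp ι Λ A + localOp ι Λ B) ψ) η
      = slice ι Λ (localOp ι Λ A ψ) η + slice ι Λ (localOp ι Λ B ψ) η := rfl
    rw [this, slice_localOp, slice_localOp]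
    rfl
  commutes' c := localOp_ext ι Λ fun ψ η => by rw [slice_localOp]; rfl
  map_star' A := by
    rw [ContinuousLinearMap.star_eq_adjoint (localOp ι Λ A)]
    refine (ContinuousLinearMap.eq_adjoint_iff _ _).2 fun φ ψ => ?_
    refine (hasSum_inner_slice ι Λ _ _).unique ?_
    convert hasSum_inner_slice ι Λ φ (localOp ι Λ A ψ) using 2 with η
    rw [slice_localOp, slice_localOp, ContinuousLinearMap.star_eq_adjoint,
      ContinuousLinearMap.adjoint_inner_left]

theorem localEmbed_injective [∀ x, Nonempty (ι x)] (Λ : Finset S) :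
    Function.Injective (localEmbed ι Λ) := by
  classical
  intro A B h
  ext1 v
  let η₀ : OuterConfig ι Λ := fun _ => Classical.arbitrary _
  let ψ : (∀ x, ι x) → ℂ := fun σ =>
    if (splitConfig ι Λ σ).2 = η₀ then v (splitConfig ι Λ σ).1 else 0
  have h0 : slice ι Λ ψ η₀ = v := by
    ext τ
    simp [slice, ψ]
  have h1 : ∀ η, η ≠ η₀ → slice ι Λ ψ η = 0 := by
    intro η hη
    ext τ
    simp [slice, ψ, hη]
  have hψ : Memℓp ψ 2 := by
    refine memℓp_of_slice ι Λ ψ (summable_of_ne_finset_zero (s := {η₀}) fun η hη => ?_)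
    rw [h1 η (by simpa using hη)]
    simp
  have := congrArg (fun T : ConfigHilbert ι →L[ℂ] ConfigHilbert ι =>
    slice ι Λ (T (⟨ψ, hψ⟩ : ConfigHilbert ι)) η₀) h
  have e : ∀ C, slice ι Λ (localEmbed ι Λ C (⟨ψ, hψ⟩ : ConfigHilbert ι)) η₀ = C v := fun C => by
    rw [← h0]
    exact slice_localOp ι Λ C _ η₀
  simpa only [e] using this

/-- The representation is isometric, so that the norm below is the one of `L(H_Λ)`. -/
theorem norm_localEmbed [∀ x, Nonempty (ι x)] (Λ : Finset S)
    (A : LocalHilbert ι Λ →L[ℂ] LocalHilbert ι Λ) : ‖localEmbed ι Λ A‖ = ‖A‖ :=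
  NonUnitalStarAlgHom.norm_map (localEmbed ι Λ) (localEmbed_injective ι Λ) A

/-- The algebra `𝒰_Λ ≅ L(H_Λ)`. -/
noncomputable def regionAlgebra (Λ : Finset S) :
    StarSubalgebra ℂ (ConfigHilbert ι →L[ℂ] ConfigHilbert ι) :=
  (localEmbed ι Λ).range

theorem regionAlgebra_mono {Λ Λ' : Finset S} (h : Λ ⊆ Λ') :
    regionAlgebra ι Λ ≤ regionAlgebra ι Λ' := by
  classical
  rintro _ ⟨A, rfl⟩
  let patch : LocalConfig ι Λ → LocalConfig ι Λ' → LocalConfig ι Λ' := fun ρ τ x =>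
    if hx : x.1 ∈ Λ then ρ ⟨x.1, hx⟩ else τ x
  let A' : LocalHilbert ι Λ' →ₗ[ℂ] LocalHilbert ι Λ' :=
    { toFun := fun v => WithLp.toLp 2 fun τ =>
        A (WithLp.toLp 2 fun ρ => v (patch ρ τ)) fun x => τ ⟨x.1, h x.2⟩
      map_add' := fun v w => by
        ext τ
        have : (WithLp.toLp 2 fun ρ => (v + w) (patch ρ τ) : LocalHilbert ι Λ)
          = WithLp.toLp 2 (fun ρ => v (patch ρ τ)) + WithLp.toLp 2 (fun ρ => w (patch ρ τ)) := rfl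
        simp only [this, map_add]
        rfl
      map_smul' := fun c v => by
        ext τ
        have : (WithLp.toLp 2 fun ρ => (c • v) (patch ρ τ) : LocalHilbert ι Λ)
          = c • WithLp.toLp 2 (fun ρ => v (patch ρ τ)) := rfl
        simp only [this, map_smul]
        rfl }
  refine ⟨LinearMap.toContinuousLinearMap A', ?_⟩
  change localOp ι Λ' _ = localOp ι Λ A
  ext1 ψ
  ext1
  funext σ
  change A (WithLp.toLp 2 fun ρ => ψ ((splitConfig ι Λ').symm
      (patch ρ (splitConfig ι Λ' σ).1, (splitConfig ι Λ' σ).2))) _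
    = A (WithLp.toLp 2 fun ρ => ψ ((splitConfig ι Λ).symm (ρ, (splitConfig ι Λ σ).2))) _
  have e : ∀ ρ, (splitConfig ι Λ').symm
      (patch ρ (splitConfig ι Λ' σ).1, (splitConfig ι Λ' σ).2)
      = (splitConfig ι Λ).symm (ρ, (splitConfig ι Λ σ).2) := by
    intro ρ
    funext x
    change (if hx : x ∈ Λ' then patch ρ (splitConfig ι Λ' σ).1 ⟨x, hx⟩ else σ x)
      = if hx : x ∈ Λ then ρ ⟨x, hx⟩ else σ x
    by_cases hx : x ∈ Λ
    · simp [patch, hx, h hx]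
    · simp only [patch, hx, dite_false]
      exact dite_eq_right_iff.2 fun _ => rfl
  simp only [e]
  rfl

/-- The algebra `𝒰_loc` of local operators, the (directed) union of the algebras `𝒰_Λ`. -/
noncomputable def localAlgebra : StarSubalgebra ℂ (ConfigHilbert ι →L[ℂ] ConfigHilbert ι) :=
  ⨆ Λ : Finset S, regionAlgebra ι Λ

theorem mem_localAlgebra {T : ConfigHilbert ι →L[ℂ] ConfigHilbert ι} :
    T ∈ localAlgebra ι ↔ ∃ Λ : Finset S, T ∈ regionAlgebra ι Λ := by
  classical
  have dir : Directed (· ≤ ·) (regionAlgebra ι) := fun Λ Λ' =>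
    ⟨Λ ∪ Λ', regionAlgebra_mono ι Finset.subset_union_left,
      regionAlgebra_mono ι Finset.subset_union_right⟩
  rw [← SetLike.mem_coe, localAlgebra, StarSubalgebra.coe_iSup_of_directed dir]
  simp

/-- The quasi-local algebra `𝒰`: the norm closure of the algebra of local operators. -/
noncomputable def quasiLocalAlgebra : StarSubalgebra ℂ (ConfigHilbert ι →L[ℂ] ConfigHilbert ι) :=
  (localAlgebra ι).topologicalClosure

/-- The elements of the quasi-local algebra. -/
abbrev QuasiLocal : Type _ := quasiLocalAlgebra ι

end QuasiLocal

/-- The nonempty finite subsets of `S`. -/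
abbrev Region (S : Type*) : Type _ := {Λ : Finset S // Λ.Nonempty}

section Dynamics

variable {S : Type*} {ι : S → Type*} [∀ x, Finite (ι x)]

/-- `A ∈ 𝒰_Λ`. -/
def InRegion (A : QuasiLocal ι) (Λ : Finset S) : Prop :=
  (A : ConfigHilbert ι →L[ℂ] ConfigHilbert ι) ∈ regionAlgebra ι Λ

/-- `A ∈ 𝒰_loc`. -/
def IsLocalOperator (A : QuasiLocal ι) : Prop :=
  (A : ConfigHilbert ι →L[ℂ] ConfigHilbert ι) ∈ localAlgebra ι

/-- The support of a local operator: the smallest set `Λ` with `A ∈ 𝒰_Λ`. -/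
def operatorSupport (A : QuasiLocal ι) : Set S :=
  {x | ∀ Λ : Finset S, InRegion A Λ → x ∈ Λ}

/-- An interaction: a family of self-adjoint elements `φ(Λ) ∈ 𝒰_Λ`. -/
structure IsInteraction (φ : Region S → QuasiLocal ι) : Prop where
  selfAdjoint : ∀ Λ, IsSelfAdjoint (φ Λ)
  inRegion : ∀ Λ, InRegion (φ Λ) Λ.1

/-- The Hamiltonian `∑_{X ⊆ Λ} φ(X)` of the finite volume `Λ`. -/
noncomputable def localHamiltonian (φ : Region S → QuasiLocal ι) (Λ : Finset S) : QuasiLocal ι :=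
  ∑ X ∈ Λ.powerset.subtype Finset.Nonempty, φ X

/-- The Heisenberg evolution `exp(itH_Λ) A exp(-itH_Λ)` of the finite volume `Λ`. -/
noncomputable def localEvolution (φ : Region S → QuasiLocal ι) (Λ : Finset S) (t : ℝ)
    (A : QuasiLocal ι) : QuasiLocal ι :=
  NormedSpace.exp ((Complex.I * t) • localHamiltonian φ Λ) * A *
    NormedSpace.exp (-(Complex.I * t) • localHamiltonian φ Λ)

/-- A time evolution: a strongly continuous one-parameter group of `*`-automorphisms. -/
structure IsTimeEvolution (α : ℝ → (QuasiLocal ι ≃⋆ₐ[ℂ] QuasiLocal ι)) : Prop where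
  zero : ∀ A, α 0 A = A
  add : ∀ s t A, α (s + t) A = α s (α t A)
  continuous : ∀ A, Continuous fun t => α t A

/-- `α` is the infinite-volume limit of the finite-volume evolutions of the interaction `φ`, along
every increasing and exhausting sequence of finite volumes. -/
def IsInducedBy (α : ℝ → (QuasiLocal ι ≃⋆ₐ[ℂ] QuasiLocal ι)) (φ : Region S → QuasiLocal ι) :
    Prop :=
  ∀ Λ : ℕ → Finset S, Monotone Λ → (∀ x, ∃ j, x ∈ Λ j) → ∀ (t : ℝ) (A : QuasiLocal ι),
    Filter.Tendsto (fun j => localEvolution φ (Λ j) t A) Filter.atTop (nhds (α t A))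

/-- The domain of the infinitesimal generator of `α`. -/
def generatorDomain (α : ℝ → (QuasiLocal ι ≃⋆ₐ[ℂ] QuasiLocal ι)) : Set (QuasiLocal ι) :=
  {A | DifferentiableAt ℝ (fun t => α t A) 0}

/-- The infinitesimal generator `δ(A) = d/dt α_t(A) |_{t = 0}` of `α`. -/
noncomputable def generator (α : ℝ → (QuasiLocal ι ≃⋆ₐ[ℂ] QuasiLocal ι)) (A : QuasiLocal ι) :
    QuasiLocal ι :=
  deriv (fun t => α t A) 0

/-- The sequence `U_1, U_2, …` lies, with its adjoints, in the domain of the generator `δ` of `α`,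
and `sup_m ‖U_m δ(U_m*) + U_m* δ(U_m)‖ < ∞`. -/
def MerminWagnerBound (α : ℝ → (QuasiLocal ι ≃⋆ₐ[ℂ] QuasiLocal ι)) (U : ℕ → QuasiLocal ι) :
    Prop :=
  (∀ m : ℕ, 1 ≤ m → U m ∈ generatorDomain α ∧ star (U m) ∈ generatorDomain α) ∧
  ∃ C : ℝ, ∀ m : ℕ, 1 ≤ m →
    ‖U m * generator α (star (U m)) + star (U m) * generator α (U m)‖ ≤ C

end Dynamics

/-! ### Multipole symmetries -/

/-- `L` is countable, and balls of radius `r` around its points contain at most `C r ^ γ` points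
of `L`, for large `r`. -/
structure HasEffectiveDimension {d : ℕ} (L : Set (EuclideanSpace ℝ (Fin d))) (γ : ℝ) : Prop where
  countable : L.Countable
  pos : 0 < γ
  growth : ∃ C : ℝ, 0 ≤ C ∧ ∃ r₀ : ℝ, 0 ≤ r₀ ∧ ∀ r : ℝ, r₀ ≤ r → ∀ z ∈ L,
    (Metric.ball z r ∩ L).Finite ∧ ((Metric.ball z r ∩ L).ncard : ℝ) ≤ C * r ^ γ

/-- `x ^ a = ∏_j x_j ^ a_j`. -/
def multiPow {d : ℕ} (a : Fin d → ℕ) (x : EuclideanSpace ℝ (Fin d)) : ℝ :=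
  ∏ j, x j ^ a j

/-- A smooth cut-off function on `ℝ`. -/
structure IsCutoff (χ : ℝ → ℝ) : Prop where
  smooth : ContDiff ℝ ((⊤ : ℕ∞) : WithTop ℕ∞) χ
  nonneg : ∀ u, 0 ≤ χ u
  le_one : ∀ u, χ u ≤ 1
  eq_one : ∀ u, |u| ≤ 1 → χ u = 1
  eq_zero : ∀ u, 2 ≤ |u| → χ u = 0

/-- `χ_m(x) = ∏_j χ(x_j / m)`. -/
noncomputable def boxCutoff {d : ℕ} (χ : ℝ → ℝ) (m : ℕ) (x : EuclideanSpace ℝ (Fin d)) : ℝ :=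
  ∏ j, χ (x j / m)

section Multipole

variable {d : ℕ} {L : Set (EuclideanSpace ℝ (Fin d))} {ι : L → Type*} [∀ x, Finite (ι x)]

/-- A family of local charge operators. -/
structure IsChargeFamily (n : L → QuasiLocal ι) : Prop where
  isLocal : ∀ x, IsLocalOperator (n x)
  selfAdjoint : ∀ x, IsSelfAdjoint (n x)
  commute : ∀ x y, Commute (n x) (n y)
  bounded : ∃ N₀ : ℝ, 0 < N₀ ∧ ∀ x, ‖n x‖ ≤ N₀
  finiteRange : ∃ R₀ : ℝ, 0 < R₀ ∧ ∀ x, operatorSupport (n x) ⊆ Metric.ball x R₀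

/-- The points `z` with `supp(n_z) ∩ Λ ≠ ∅`. -/
def chargesMeeting (n : L → QuasiLocal ι) (Λ : Finset L) : Set L :=
  {z | (operatorSupport (n z) ∩ (Λ : Set L)).Nonempty}

/-- The multipole moment `∑ x ^ a n_x`, over all `x` with `supp(n_x) ∩ Λ ≠ ∅`. -/
noncomputable def multipoleMoment (n : L → QuasiLocal ι) (a : Fin d → ℕ) (Λ : Finset L) :
    QuasiLocal ι :=
  ∑ᶠ x ∈ chargesMeeting n Λ, ((multiPow a (x : EuclideanSpace ℝ (Fin d)) : ℝ) : ℂ) • n x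

/-- The multipole symmetry `τ_s^{(a)}` on `𝒰_Λ`. -/
noncomputable def multipoleSymmetry (n : L → QuasiLocal ι) (a : Fin d → ℕ) (s : ℝ)
    (Λ : Finset L) (A : QuasiLocal ι) : QuasiLocal ι :=
  NormedSpace.exp (-(Complex.I * s) • multipoleMoment n a Λ) * A *
    NormedSpace.exp ((Complex.I * s) • multipoleMoment n a Λ)

/-- `τ_s^{(a)}(φ(Λ)) = φ(Λ)` for all `s` and `Λ`. -/
def IsMultipoleInvariant (n : L → QuasiLocal ι) (φ : Region L → QuasiLocal ι)
    (a : Fin d → ℕ) : Prop :=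
  ∀ (Λ : Region L) (s : ℝ), multipoleSymmetry n a s Λ.1 (φ Λ) = φ Λ

/-- `sup_x ∑_{Λ ∋ x} ‖φ(Λ)‖ (∑_{z : supp(n_z) ∩ Λ ≠ ∅} |z - x| ^ (k + 1)) ^ 2 < ∞`. -/
def MomentDecay (n : L → QuasiLocal ι) (φ : Region L → QuasiLocal ι) (k : ℕ) : Prop :=
  ⨆ x : L, ∑' Λ : {Λ : Region L // x ∈ Λ.1},
    ‖φ Λ.1‖ₑ * (∑' z : chargesMeeting n Λ.1.1, edist (z : L) x ^ (k + 1)) ^ 2 < ⊤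

/-- `sup_{x,y} (1 + |x - y|) ^ (γ + 1 + ε) ∑_{Λ ∋ x, y} ‖φ(Λ)‖ < ∞` for some `ε > 0`. -/
def PairDecay (φ : Region L → QuasiLocal ι) (γ : ℝ) : Prop :=
  ∃ ε : ℝ, 0 < ε ∧ ⨆ x : L, ⨆ y : L, ENNReal.ofReal ((1 + dist x y) ^ (γ + 1 + ε)) *
    ∑' Λ : {Λ : Region L // x ∈ Λ.1 ∧ y ∈ Λ.1}, ‖φ Λ.1‖ₑ < ⊤

/-- The truncated unitary `U_m^{(a)}(s) = exp(i s ∑_x χ_m(x) x ^ a n_x)`. -/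
noncomputable def truncatedUnitary (n : L → QuasiLocal ι) (χ : ℝ → ℝ) (a : Fin d → ℕ) (s : ℝ)
    (m : ℕ) : QuasiLocal ι :=
  NormedSpace.exp ((Complex.I * s) • ∑ᶠ x : L,
    ((boxCutoff χ m (x : EuclideanSpace ℝ (Fin d)) *
      multiPow a (x : EuclideanSpace ℝ (Fin d)) : ℝ) : ℂ) • n x)

end Multipole

/-! The argument has two parts.

Dynamics. Writing `|Z|` as a sum over `y ∈ Z` and using the growth of `L`, pair decay gives `∑_{Z ∋
x} |Z| ‖φ(Z)‖ ≤ κ` uniformly in `x` (`PairDecay.exists_sum_le`). Two finite-volume evolutions of an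
element localized in `X` are compared in the interaction picture: terms away from `X` commute with
it, so only the evolved terms meeting `X` contribute, and these are again localized. Iterating `n`
times leaves `|X| (2κt)^n / n!` up to an arbitrarily small tail (`IsShortRange.flow_sub_flow_le`),
so the evolutions converge at all times. A Taylor bound uniform in the volume puts local elements in
the domain of the generator, which acts on them as the sum of commutators
(`IsShortRange.hasDerivAt_limitFlow`).

Mermin–Wagner bound. Since `U (kU* - U*k) + U* (kU - Uk) = UkU* + U*kU - 2k`, the quantity to bound
is a sum over `Z` of second differences, in which first-order terms cancel
(`IsShortRange.norm_generator_le`). Each is quadratic in the generator of `U`. That generator may be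
changed by charges not meeting `Z` and by any polynomial moment of degree at most `k`, as these
commute with `φ(Z)`. Subtracting from `χ_m(x) x^a` its Taylor polynomial at a point `y ∈ Z` leaves
coefficients of size `m^(|a|-k-1) |z-y|^(k+1)`. The square is summable over `Z ∋ y` by moment decay,
and only `O(m^γ)` points `y` matter. The total is `O(m^(γ - 2(k-|a|+1)))`, bounded exactly under the
assumption on `γ` (`exists_sum_secondDifference_le`).

Bounded directions. Once `m` exceeds the bounds `M_j`, the cut-offs in the directions `I` equal one
on `L`, so the truncated monomial depends only on the other coordinates and its Taylor polynomial
uses only exponents in `T_k`. The finitely many smaller `m` only enlarge the constant. -/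

/-! ### Conjugation by the exponentials of a skew-adjoint element -/

section Flow

open NormedSpace

variable {𝒜 : Type*} [CStarAlgebra 𝒜]

/-- The conjugation `exp(tK) A exp(-tK)`. -/
noncomputable def flow (K : 𝒜) (t : ℝ) (A : 𝒜) : 𝒜 :=
  exp (t • K) * A * exp (-(t • K))

theorem exp_mul_exp_neg (K : 𝒜) : exp K * exp (-K) = 1 := by
  let : NormedAlgebra ℚ 𝒜 := NormedAlgebra.restrictScalars ℚ ℝ 𝒜
  rw [← exp_add_of_commute (Commute.refl K).neg_right, add_neg_cancel, exp_zero]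

theorem exp_neg_mul_exp (K : 𝒜) : exp (-K) * exp K = 1 := by
  simpa using exp_mul_exp_neg (-K)

theorem exp_mem_unitary {K : 𝒜} (hK : star K = -K) : exp K ∈ unitary 𝒜 := by
  let : NormedAlgebra ℚ 𝒜 := NormedAlgebra.restrictScalars ℚ ℝ 𝒜
  exact exp_mem_unitary_of_mem_skewAdjoint (skewAdjoint.mem_iff.2 hK)

theorem star_smul_skew {K : 𝒜} (hK : star K = -K) (t : ℝ) : star (t • K) = -(t • K) := by
  rw [star_smul, hK, star_trivial, smul_neg]

theorem star_neg_skew {K : 𝒜} (hK : star K = -K) : star (-K) = -(-K) := by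
  rw [star_neg, hK]

theorem norm_exp_mul {K : 𝒜} (hK : star K = -K) (A : 𝒜) : ‖exp K * A‖ = ‖A‖ :=
  CStarRing.norm_mem_unitary_mul A (exp_mem_unitary hK)

theorem norm_mul_exp {K : 𝒜} (hK : star K = -K) (A : 𝒜) : ‖A * exp K‖ = ‖A‖ :=
  CStarRing.norm_mul_mem_unitary A (exp_mem_unitary hK)

theorem norm_flow {K : 𝒜} (hK : star K = -K) (t : ℝ) (A : 𝒜) : ‖flow K t A‖ = ‖A‖ := by
  rw [flow, norm_mul_exp (star_neg_skew (star_smul_skew hK t)),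
    norm_exp_mul (star_smul_skew hK t)]

theorem flow_zero (K A : 𝒜) : flow K 0 A = A := by simp [flow]

theorem flow_add_right (K : 𝒜) (t : ℝ) (A B : 𝒜) :
    flow K t (A + B) = flow K t A + flow K t B := by
  simp only [flow, mul_add, add_mul]

theorem flow_sub_right (K : 𝒜) (t : ℝ) (A B : 𝒜) :
    flow K t (A - B) = flow K t A - flow K t B := by
  simp only [flow, mul_sub, sub_mul]

theorem flow_sum {β : Type*} (K : 𝒜) (t : ℝ) (s : Finset β) (f : β → 𝒜) :
    flow K t (∑ i ∈ s, f i) = ∑ i ∈ s, flow K t (f i) := by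
  simp only [flow, Finset.mul_sum, Finset.sum_mul]

theorem flow_smul (K : 𝒜) (t : ℝ) (c : ℂ) (A : 𝒜) : flow K t (c • A) = c • flow K t A := by
  simp only [flow, mul_smul_comm, smul_mul_assoc]

theorem flow_mul (K : 𝒜) (t : ℝ) (A B : 𝒜) : flow K t (A * B) = flow K t A * flow K t B := by
  simp only [flow]
  calc _ = exp (t • K) * A * 1 * B * exp (-(t • K)) := by simp only [mul_assoc, one_mul]
    _ = _ := by rw [← exp_neg_mul_exp (t • K)]; simp only [mul_assoc]

theorem star_exp_skew {K : 𝒜} (hK : star K = -K) : star (exp K) = exp (-K) := by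
  let : NormedAlgebra ℚ 𝒜 := NormedAlgebra.restrictScalars ℚ ℝ 𝒜
  rw [NormedSpace.star_exp, hK]

theorem flow_star {K : 𝒜} (hK : star K = -K) (t : ℝ) (A : 𝒜) :
    flow K t (star A) = star (flow K t A) := by
  simp only [flow, star_mul, star_exp_skew (star_smul_skew hK t),
    star_exp_skew (star_neg_skew (star_smul_skew hK t)), neg_neg, mul_assoc]

theorem flow_add_time (K : 𝒜) (s t : ℝ) (A : 𝒜) : flow K (s + t) A = flow K s (flow K t A) := by
  let : NormedAlgebra ℚ 𝒜 := NormedAlgebra.restrictScalars ℚ ℝ 𝒜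
  have h : Commute (s • K) (t • K) := ((Commute.refl K).smul_left s).smul_right t
  have e : -((s + t) • K) = -(t • K) + -(s • K) := by rw [add_smul]; abel
  simp only [flow]
  rw [e, add_smul, exp_add_of_commute h, exp_add_of_commute h.symm.neg_left.neg_right]
  simp only [mul_assoc]

theorem flow_neg_time (K : 𝒜) (t : ℝ) (A : 𝒜) : flow K (-t) A = flow (-K) t A := by
  simp only [flow, neg_smul, smul_neg]

theorem commute_exp {K A : 𝒜} (h : Commute K A) : Commute (exp K) A := by
  let : NormedAlgebra ℚ 𝒜 := NormedAlgebra.restrictScalars ℚ ℝ 𝒜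
  exact (h.symm.exp_right).symm

theorem flow_of_commute {K A : 𝒜} (h : Commute K A) (t : ℝ) : flow K t A = A := by
  rw [flow, (commute_exp (h.smul_left t)).eq, mul_assoc, exp_mul_exp_neg, mul_one]

theorem hasDerivAt_exp_neg_smul (K : 𝒜) (t : ℝ) :
    HasDerivAt (fun u : ℝ => exp (-(u • K))) (-(K * exp (-(t • K)))) t := by
  have := hasDerivAt_exp_smul_const' (𝕂 := ℝ) (-K) t
  simpa only [smul_neg, neg_mul] using this

theorem hasDerivAt_flow (K A : 𝒜) (t : ℝ) :
    HasDerivAt (fun u => flow K u A) (flow K t (K * A - A * K)) t := by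
  have h1 := hasDerivAt_exp_smul_const (𝕂 := ℝ) K t
  have h := (h1.mul_const A).mul (hasDerivAt_exp_neg_smul K t)
  refine h.congr_deriv ?_
  simp only [flow, mul_sub, sub_mul, mul_assoc, mul_neg]
  abel

/-- Mean value inequality: the derivative is the conjugated commutator, whose norm does not depend
on time because the exponentials are unitary. -/
theorem norm_flow_sub_self_le {K : 𝒜} (hK : star K = -K) (t : ℝ) (A : 𝒜) :
    ‖flow K t A - A‖ ≤ ‖K * A - A * K‖ * |t| := by
  have := Convex.norm_image_sub_le_of_norm_hasDerivWithin_le (f := fun u => flow K u A)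
    (f' := fun u => flow K u (K * A - A * K)) (s := Set.univ) (C := ‖K * A - A * K‖)
    (x := 0) (y := t) (fun u _ => (hasDerivAt_flow K A u).hasDerivWithinAt)
    (fun u _ => (norm_flow hK u _).le) convex_univ trivial trivial
  simpa [flow_zero] using this

theorem norm_commutator_le (K A : 𝒜) : ‖K * A - A * K‖ ≤ 2 * ‖K‖ * ‖A‖ := by
  refine (norm_sub_le _ _).trans ?_
  have h1 := norm_mul_le K A
  have h2 := norm_mul_le A K
  linarith

/-- The second difference of the conjugation is bounded by the double commutator. -/
theorem norm_flow_add_flow_neg_sub_le {K : 𝒜} (hK : star K = -K) (t : ℝ) (A : 𝒜) :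
    ‖flow K t A + flow K (-t) A - (2 : ℝ) • A‖ ≤ 8 * t ^ 2 * ‖K‖ ^ 2 * ‖A‖ := by
  set B := K * A - A * K with hB
  have hd : ∀ u, HasDerivAt (fun u => flow K u A + flow K (-u) A)
      (flow K u B - flow K (-u) B) u := by
    intro u
    have h2 := (hasDerivAt_flow K A (-u)).scomp u (hasDerivAt_neg u)
    refine ((hasDerivAt_flow K A u).add h2).congr_deriv ?_
    simp only [neg_smul, one_smul, hB, sub_eq_add_neg]
  have hb : ‖B‖ ≤ 2 * ‖K‖ * ‖A‖ := norm_commutator_le K A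
  have hb2 : ‖K * B - B * K‖ ≤ 4 * ‖K‖ ^ 2 * ‖A‖ := by
    refine (norm_commutator_le K B).trans ?_
    calc 2 * ‖K‖ * ‖B‖ ≤ 2 * ‖K‖ * (2 * ‖K‖ * ‖A‖) := by gcongr
      _ = _ := by ring
  -- The derivative is a difference of evolved copies of the commutator `B` at times `u` and `-u`.
  -- Each is within `‖[K, B]‖ |u|` of `B`, which supplies the second power of `t`.
  have hbound : ∀ u ∈ Set.uIcc 0 t, ‖flow K u B - flow K (-u) B‖ ≤ 8 * ‖K‖ ^ 2 * ‖A‖ * |t| := by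
    intro u hu
    have hut : |u| ≤ |t| := by
      have := Set.abs_sub_left_of_mem_uIcc hu
      simpa using this
    have e : flow K u B - flow K (-u) B = (flow K u B - B) - (flow K (-u) B - B) := by abel
    rw [e]
    refine (norm_sub_le _ _).trans ?_
    have h1 := norm_flow_sub_self_le hK u B
    have h2 := norm_flow_sub_self_le hK (-u) B
    rw [abs_neg] at h2
    have h3 : ‖K * B - B * K‖ * |u| ≤ 4 * ‖K‖ ^ 2 * ‖A‖ * |t| := by gcongr
    linarith
  have := Convex.norm_image_sub_le_of_norm_hasDerivWithin_le
    (f := fun u => flow K u A + flow K (-u) A)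
    (fun u _ => (hd u).hasDerivWithinAt) hbound (convex_uIcc 0 t)
    Set.left_mem_uIcc Set.right_mem_uIcc
  simp only [neg_zero, flow_zero, sub_zero, Real.norm_eq_abs] at this
  rw [two_smul]
  refine this.trans (le_of_eq ?_)
  rw [← sq_abs t]
  ring

end Flow

/-! ### Comparison of two evolutions in the interaction picture -/

section InteractionPicture

open NormedSpace

variable {𝒜 : Type*} [CStarAlgebra 𝒜]

/-- The product of propagators which compares the evolutions generated by `K` and `K'`, relative to
the evolutions generated by `Q` and `Q'`. -/
noncomputable def waveOp (K Q K' Q' : 𝒜) (t : ℝ) : 𝒜 :=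
  (exp (t • Q) * exp (-(t • K))) * (exp (t • K') * exp (-(t • Q')))

theorem waveOp_zero (K Q K' Q' : 𝒜) : waveOp K Q K' Q' 0 = 1 := by simp [waveOp]

/-- The first propagator has derivative `exp(tQ) (Q - K) exp(-tK)` and the second `exp(tK') (K' -
Q') exp(-tQ')`; moving the inner exponentials aside turns the middle factors into conjugations. -/
theorem hasDerivAt_waveOp (K Q K' Q' : 𝒜) (t : ℝ) :
    HasDerivAt (waveOp K Q K' Q') ((exp (t • Q) * exp (-(t • K))) *
      (flow K' t (K' - Q') - flow K t (K - Q)) * (exp (t • K') * exp (-(t • Q')))) t := by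
  have h1 := (hasDerivAt_exp_smul_const (𝕂 := ℝ) Q t).mul (hasDerivAt_exp_neg_smul K t)
  have h2 := (hasDerivAt_exp_smul_const (𝕂 := ℝ) K' t).mul (hasDerivAt_exp_neg_smul Q' t)
  refine (h1.mul h2).congr_deriv ?_
  have c1 : ∀ X : 𝒜, exp (-(t • K)) * (exp (t • K) * X) = X := fun X => by
    rw [← mul_assoc, exp_neg_mul_exp, one_mul]
  have c2 : ∀ X : 𝒜, exp (-(t • K')) * (exp (t • K') * X) = X := fun X => by
    rw [← mul_assoc, exp_neg_mul_exp, one_mul]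
  simp only [flow, Pi.mul_apply, mul_sub, sub_mul, mul_assoc, mul_neg, neg_mul, mul_add, add_mul,
    c1, c2]
  abel

/-- As `Q` and `Q'` commute with `A`, it passes through the outer exponentials and is conjugated
only by the inner ones. -/
theorem waveOp_commutator {K Q K' Q' A : 𝒜} (hQ : Commute Q A) (hQ' : Commute Q' A) (t : ℝ) :
    waveOp K Q K' Q' t * A - A * waveOp K Q K' Q' t =
      (exp (t • Q) * exp (-(t • K))) * (flow K' t A - flow K t A) *
        (exp (t • K') * exp (-(t • Q'))) := by
  have c1 : ∀ X : 𝒜, exp (-(t • K)) * (exp (t • K) * X) = X := fun X => by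
    rw [← mul_assoc, exp_neg_mul_exp, one_mul]
  have c2 : ∀ X : 𝒜, exp (-(t • K')) * (exp (t • K') * X) = X := fun X => by
    rw [← mul_assoc, exp_neg_mul_exp, one_mul]
  have e1 := (commute_exp (hQ.smul_left t)).eq
  have e2 := (commute_exp (hQ'.smul_left t).neg_left).eq
  have e3 : ∀ X : 𝒜, exp (t • Q) * (A * X) = A * (exp (t • Q) * X) := fun X => by
    rw [← mul_assoc, e1, mul_assoc]
  simp only [waveOp, flow, mul_sub, sub_mul, mul_assoc, c1, c2, e2, e3]

theorem norm_propagator_mul {K Q : 𝒜} (hK : star K = -K) (hQ : star Q = -Q) (t : ℝ) (A : 𝒜) :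
    ‖exp (t • Q) * exp (-(t • K)) * A‖ = ‖A‖ := by
  rw [mul_assoc, norm_exp_mul (star_smul_skew hQ t),
    norm_exp_mul (star_neg_skew (star_smul_skew hK t))]

theorem norm_mul_propagator {K Q : 𝒜} (hK : star K = -K) (hQ : star Q = -Q) (t : ℝ) (A : 𝒜) :
    ‖A * (exp (t • K) * exp (-(t • Q)))‖ = ‖A‖ := by
  rw [← mul_assoc, norm_mul_exp (star_neg_skew (star_smul_skew hQ t)),
    norm_mul_exp (star_smul_skew hK t)]

/-- Comparison of two evolutions on an element commuting with parts `Q`, `Q'` of the generators: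
only the remaining parts of the generators, evolved in time, contribute. -/
theorem norm_flow_sub_flow_le {K Q K' Q' A : 𝒜} (hK : star K = -K) (hQs : star Q = -Q)
    (hK' : star K' = -K') (hQs' : star Q' = -Q') (hQ : Commute Q A) (hQ' : Commute Q' A)
    {T : ℝ} {B B' : ℝ → ℝ} (hB0 : B 0 = 0) (hB : ∀ t, HasDerivAt B (B' t) t)
    (hbound : ∀ t ∈ Set.Icc 0 T, ‖flow K' t (K' - Q') - flow K t (K - Q)‖ ≤ B' t) :
    ∀ t ∈ Set.Icc 0 T, ‖flow K' t A - flow K t A‖ ≤ ‖A‖ * (2 * B t) := by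
  intro t ht
  -- The outer propagators are unitary, so the speed of the wave operator is the norm bounded by
  -- `hbound`.
  have hW : ‖waveOp K Q K' Q' t - 1‖ ≤ B t := by
    refine image_norm_le_of_norm_deriv_right_le_deriv_boundary
      (f := fun t => waveOp K Q K' Q' t - 1) (a := 0) (b := T)
      (fun u _ => ((hasDerivAt_waveOp K Q K' Q' u).sub_const 1).continuousAt.continuousWithinAt)
      (fun u _ => ((hasDerivAt_waveOp K Q K' Q' u).sub_const 1).hasDerivWithinAt)
      (by simp [waveOp_zero, hB0]) hB (fun u hu => ?_) ht
    rw [norm_mul_propagator hK' hQs', norm_propagator_mul hK hQs]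
    exact hbound u ⟨hu.1, hu.2.le⟩
  have e := congrArg norm (waveOp_commutator (K := K) (K' := K') hQ hQ' t)
  rw [norm_mul_propagator hK' hQs', norm_propagator_mul hK hQs] at e
  rw [← e]
  -- Subtracting the identity does not change the commutator but makes the factor small.
  have e2 : waveOp K Q K' Q' t * A - A * waveOp K Q K' Q' t
      = (waveOp K Q K' Q' t - 1) * A - A * (waveOp K Q K' Q' t - 1) := by
    rw [sub_mul, mul_sub]
    simp
  rw [e2]
  refine (norm_commutator_le _ _).trans ?_
  calc 2 * ‖waveOp K Q K' Q' t - 1‖ * ‖A‖ ≤ 2 * B t * ‖A‖ := by gcongr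
    _ = _ := by ring

end InteractionPicture

/-! ### Finite-volume estimates for short-range interactions -/

section ShortRange

variable {S : Type*} {𝒜 : Type*} [CStarAlgebra 𝒜]

/-- `A` commutes with the terms of the interaction outside `X`. -/
def LocalizedIn (k : Region S → 𝒜) (X : Finset S) (A : 𝒜) : Prop :=
  ∀ Z : Region S, Disjoint Z.1 X → Commute (k Z) A

open scoped Classical in
/-- A family of skew-adjoint terms `k(Z)`, commuting for disjoint regions, with
`∑_{Z ∋ x} |Z| ‖k(Z)‖ ≤ κ` for all `x`. -/
structure IsShortRange (k : Region S → 𝒜) (κ : ℝ) : Prop where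
  skew : ∀ Z, star (k Z) = -k Z
  localized : ∀ Z : Region S, LocalizedIn k Z.1 (k Z)
  sum_le : ∀ (x : S) (R : Finset (Region S)), ∑ Z ∈ R with x ∈ Z.1, (Z.1.card : ℝ) * ‖k Z‖ ≤ κ

open scoped Classical in
theorem sum_meeting_le {X : Finset S} (R : Finset (Region S)) {f : Region S → ℝ}
    (hf : ∀ Z, 0 ≤ f Z) :
    ∑ Z ∈ R with ¬ Disjoint Z.1 X, f Z ≤ ∑ x ∈ X, ∑ Z ∈ R with x ∈ Z.1, f Z := by
  simp only [Finset.sum_filter]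
  rw [Finset.sum_comm]
  refine Finset.sum_le_sum fun Z _ => ?_
  by_cases h : Disjoint Z.1 X
  · rw [if_neg (not_not.2 h)]
    exact Finset.sum_nonneg fun y _ => by split_ifs; exacts [hf Z, le_rfl]
  · rw [if_pos h]
    obtain ⟨x, hxZ, hxX⟩ := Finset.not_disjoint_iff.1 h
    refine le_trans (le_of_eq (by simp [hxZ])) (Finset.single_le_sum
      (f := fun x => if x ∈ Z.1 then f Z else 0) (fun y _ => ?_) hxX)
    split_ifs
    exacts [hf Z, le_rfl]

namespace IsShortRange

variable {k : Region S → 𝒜} {κ : ℝ}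

theorem neg (h : IsShortRange k κ) : IsShortRange (fun Z => -k Z) κ where
  skew Z := by rw [star_neg, h.skew]
  localized Z W hW := (h.localized Z W hW).neg_left.neg_right
  sum_le x R := by simpa only [norm_neg] using h.sum_le x R

theorem star_sum (h : IsShortRange k κ) (R : Finset (Region S)) :
    star (∑ Z ∈ R, k Z) = -∑ Z ∈ R, k Z := by
  rw [_root_.star_sum, ← Finset.sum_neg_distrib]
  exact Finset.sum_congr rfl fun Z _ => h.skew Z

open scoped Classical in
theorem sum_card_meeting_le (h : IsShortRange k κ) (X : Finset S) (R : Finset (Region S)) :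
    ∑ Z ∈ R with ¬ Disjoint Z.1 X, (Z.1.card : ℝ) * ‖k Z‖ ≤ X.card * κ := by
  refine (sum_meeting_le R fun Z => by positivity).trans ?_
  refine (Finset.sum_le_sum fun x _ => h.sum_le x R).trans (le_of_eq ?_)
  rw [Finset.sum_const, nsmul_eq_mul]

open scoped Classical in
theorem sum_norm_meeting_le (h : IsShortRange k κ) (X : Finset S) (R : Finset (Region S)) :
    ∑ Z ∈ R with ¬ Disjoint Z.1 X, ‖k Z‖ ≤ X.card * κ := by
  refine (Finset.sum_le_sum fun Z _ => ?_).trans (h.sum_card_meeting_le X R)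
  have : (1 : ℝ) ≤ Z.1.card := by exact_mod_cast Z.2.card_pos
  nlinarith [norm_nonneg (k Z)]

open scoped Classical in
theorem summable_meeting (h : IsShortRange k κ) (X : Finset S) :
    Summable fun Z : Region S => if ¬ Disjoint Z.1 X then ‖k Z‖ else 0 := by
  refine summable_of_sum_le (c := X.card * κ) (fun Z => by dsimp only; split_ifs <;> positivity)
    fun R => ?_
  rw [← Finset.sum_filter]
  exact h.sum_norm_meeting_le X R

open scoped Classical in
theorem exists_tail_le (h : IsShortRange k κ) (X : Finset S) {η : ℝ} (hη : 0 < η) :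
    ∃ F : Finset (Region S), ∀ R : Finset (Region S), Disjoint R F →
      ∑ Z ∈ R with ¬ Disjoint Z.1 X, ‖k Z‖ ≤ η := by
  obtain ⟨F, hF⟩ := summable_iff_vanishing_norm.1 (h.summable_meeting X) η hη
  refine ⟨F, fun R hR => ?_⟩
  have := hF R hR
  rw [← Finset.sum_filter] at this
  exact (le_abs_self _).trans this.le

theorem kappa_nonneg (h : IsShortRange k κ) (X : Region S) : 0 ≤ κ := by
  obtain ⟨x, -⟩ := X.2
  simpa using h.sum_le x ∅

open scoped Classical in
theorem sum_sub_sum_disjoint (X : Finset S) (R : Finset (Region S)) :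
    ∑ Z ∈ R, k Z - ∑ Z ∈ R with Disjoint Z.1 X, k Z = ∑ Z ∈ R with ¬ Disjoint Z.1 X, k Z := by
  rw [← Finset.sum_filter_add_sum_filter_not R (fun Z => Disjoint Z.1 X)]
  abel

open scoped Classical in
theorem commute_sum_disjoint {X : Finset S} {A : 𝒜} (hA : LocalizedIn k X A)
    (R : Finset (Region S)) : Commute (∑ Z ∈ R with Disjoint Z.1 X, k Z) A :=
  Commute.sum_left _ _ _ fun Z hZ => hA Z (Finset.mem_filter.1 hZ).2

open scoped Classical in
theorem sum_commutator {X : Finset S} {A : 𝒜} (hA : LocalizedIn k X A) (R : Finset (Region S)) :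
    (∑ Z ∈ R, k Z) * A - A * ∑ Z ∈ R, k Z
      = (∑ Z ∈ R with ¬ Disjoint Z.1 X, k Z) * A - A * ∑ Z ∈ R with ¬ Disjoint Z.1 X, k Z := by
  rw [← sum_sub_sum_disjoint, sub_mul, mul_sub, (commute_sum_disjoint hA R).eq]
  abel

open scoped Classical in
theorem norm_commutator_le (h : IsShortRange k κ) {X : Finset S} {A : 𝒜}
    (hA : LocalizedIn k X A) (R : Finset (Region S)) :
    ‖(∑ Z ∈ R, k Z) * A - A * ∑ Z ∈ R, k Z‖ ≤ 2 * (X.card * κ) * ‖A‖ := by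
  rw [sum_commutator hA]
  refine (_root_.norm_commutator_le _ _).trans ?_
  gcongr
  exact (norm_sum_le _ _).trans (h.sum_norm_meeting_le X R)

/-- The comparison function for the induction below: integrating the bound of order `n` over time
yields the bound of order `n + 1`. -/
theorem hasDerivAt_majorant (c b κ : ℝ) (n : ℕ) (t : ℝ) :
    HasDerivAt (fun t => c * t + b * (2 * κ * t) ^ (n + 1) / (n + 1).factorial)
      (c + 2 * b * κ * (2 * κ * t) ^ n / n.factorial) t := by
  have h1 : HasDerivAt (fun t => c * t) c t := by simpa using (hasDerivAt_id t).const_mul c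
  have h2 : HasDerivAt (fun t => 2 * κ * t) (2 * κ) t := by
    simpa using (hasDerivAt_id t).const_mul (2 * κ)
  have h3 := ((h2.pow (n + 1)).const_mul b).div_const ((n + 1).factorial : ℝ)
  refine (h1.add h3).congr_deriv ?_
  have : (n.factorial : ℝ) ≠ 0 := by positivity
  have : ((n : ℝ) + 1) ≠ 0 := by positivity
  rw [Nat.factorial_succ]
  push_cast
  field_simp

open scoped Classical in
-- The Dyson expansion run as an induction. The difference on `A` is governed by the differences on
-- the terms `k(Z)` meeting `X`; the induction hypothesis for `k(Z)` costs a factor `|Z|`, which is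
-- why short range is measured with the weight `|Z|`. The slack `η` absorbs all but finitely many
-- terms.
theorem flow_sub_flow_le (h : IsShortRange k κ) {T : ℝ} (hT : 0 ≤ T) (n : ℕ) :
    ∀ (X : Region S) (η : ℝ), 0 < η → ∃ R₀ : Finset (Region S), ∀ R R' : Finset (Region S),
      R₀ ⊆ R → R ⊆ R' → ∀ t ∈ Set.Icc 0 T, ∀ A, LocalizedIn k X.1 A →
        ‖flow (∑ Z ∈ R', k Z) t A - flow (∑ Z ∈ R, k Z) t A‖
          ≤ ‖A‖ * (η + 2 * X.1.card * (2 * κ * t) ^ n / n.factorial) := by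
  induction n with
  | zero =>
    intro X η hη
    refine ⟨∅, fun R R' _ _ t _ A _ => (norm_sub_le _ _).trans ?_⟩
    rw [norm_flow (h.star_sum _), norm_flow (h.star_sum _)]
    have : (1 : ℝ) ≤ X.1.card := by exact_mod_cast X.2.card_pos
    simp only [pow_zero, Nat.factorial_zero, Nat.cast_one, mul_one, div_one]
    nlinarith [norm_nonneg A]
  | succ n ih =>
    intro X η hη
    have hκ := h.kappa_nonneg X
    set C : ℝ := X.1.card * κ with hC
    have hC0 : 0 ≤ C := by positivity
    -- The errors add up to `(C + 2) ε`: at most `C ε` from the terms in `F` and `ε` from each of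
    -- the two tails. Integration over time and the commutator contribute `2T`.
    set ε : ℝ := η / (2 * (C + 2) * (T + 1)) with hε
    have hε0 : 0 < ε := by positivity
    obtain ⟨F, hF⟩ := h.exists_tail_le X.1 hε0
    -- Each `Z` has its own threshold `G Z`; since `F` is finite, one threshold serves all its
    -- members.
    choose G hG using fun Z => ih Z ε hε0
    refine ⟨F ∪ F.biUnion G, fun R R' hR hRR' t ht A hA => ?_⟩
    have hFR : F ⊆ R := Finset.subset_union_left.trans hR
    have hFR' : F ⊆ R' := hFR.trans hRR'
    have hb : ∀ u ∈ Set.Icc 0 T,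
        ‖flow (∑ Z ∈ R', k Z) u (∑ Z ∈ R', k Z - ∑ Z ∈ R' with Disjoint Z.1 X.1, k Z)
          - flow (∑ Z ∈ R, k Z) u (∑ Z ∈ R, k Z - ∑ Z ∈ R with Disjoint Z.1 X.1, k Z)‖
        ≤ (C + 2) * ε + 2 * X.1.card * κ * (2 * κ * u) ^ n / n.factorial := by
      intro u hu
      have split : ∀ {P : Finset (Region S)}, F ⊆ P → ∀ f : Region S → 𝒜,
          ∑ Z ∈ P with ¬ Disjoint Z.1 X.1, f Z = ∑ Z ∈ F with ¬ Disjoint Z.1 X.1, f Z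
            + ∑ Z ∈ P \ F with ¬ Disjoint Z.1 X.1, f Z := by
        intro P hP f
        simp only [Finset.sum_filter]
        rw [add_comm, Finset.sum_sdiff hP]
      have tail : ∀ P P' : Finset (Region S),
          ‖∑ Z ∈ P \ F with ¬ Disjoint Z.1 X.1, flow (∑ Z ∈ P', k Z) u (k Z)‖ ≤ ε := by
        intro P P'
        refine (norm_sum_le _ _).trans ?_
        simp only [norm_flow (h.star_sum P')]
        exact hF _ Finset.sdiff_disjoint
      rw [sum_sub_sum_disjoint, sum_sub_sum_disjoint, flow_sum, flow_sum, split hFR',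
        split hFR, add_sub_add_comm, ← Finset.sum_sub_distrib]
      refine (norm_add_le _ _).trans ?_
      have h1 : ‖∑ Z ∈ F with ¬ Disjoint Z.1 X.1, (flow (∑ Z ∈ R', k Z) u (k Z)
          - flow (∑ Z ∈ R, k Z) u (k Z))‖
          ≤ C * ε + 2 * X.1.card * κ * (2 * κ * u) ^ n / n.factorial := by
        refine (norm_sum_le _ _).trans ?_
        have : ∀ Z ∈ F.filter (fun Z => ¬ Disjoint Z.1 X.1),
            ‖flow (∑ Z ∈ R', k Z) u (k Z) - flow (∑ Z ∈ R, k Z) u (k Z)‖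
            ≤ ε * ‖k Z‖ + 2 * ((2 * κ * u) ^ n / n.factorial) * (Z.1.card * ‖k Z‖) := by
          intro Z hZ
          have hGZ : G Z ⊆ R := ((Finset.subset_biUnion_of_mem G
            (Finset.mem_filter.1 hZ).1).trans Finset.subset_union_right).trans hR
          refine (hG Z R R' hGZ hRR' u hu (k Z) (h.localized Z)).trans (le_of_eq ?_)
          ring
        refine (Finset.sum_le_sum this).trans ?_
        rw [Finset.sum_add_distrib, ← Finset.mul_sum, ← Finset.mul_sum]
        have hu0 : 0 ≤ u := hu.1
        calc _ ≤ ε * C + 2 * ((2 * κ * u) ^ n / n.factorial) * C := by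
              gcongr
              exacts [h.sum_norm_meeting_le X.1 F, h.sum_card_meeting_le X.1 F]
          _ = _ := by rw [hC]; ring
      have h2 := (norm_sub_le _ _).trans (add_le_add (tail R' R') (tail R R))
      refine (add_le_add h1 h2).trans (le_of_eq ?_)
      ring
    have := norm_flow_sub_flow_le (h.star_sum R) (h.star_sum _) (h.star_sum R') (h.star_sum _)
      (commute_sum_disjoint hA R) (commute_sum_disjoint hA R') (by simp)
      (hasDerivAt_majorant ((C + 2) * ε) X.1.card κ n) hb t ht
    refine this.trans ?_
    have hs : 2 * ((C + 2) * ε * t) ≤ η := by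
      calc 2 * ((C + 2) * ε * t) ≤ 2 * ((C + 2) * ε * (T + 1)) := by
            gcongr
            linarith [ht.2]
        _ = η := by rw [hε]; field_simp
    refine mul_le_mul_of_nonneg_left ?_ (norm_nonneg A)
    rw [mul_add]
    refine add_le_add hs (le_of_eq ?_)
    ring

end IsShortRange

end ShortRange

/-! ### The infinite-volume evolution and its generator -/

section InfiniteVolume

open NormedSpace Filter Topology

variable {S : Type*} {𝒜 : Type*} [CStarAlgebra 𝒜] {k : Region S → 𝒜} {κ : ℝ}

/-- The infinite-volume limit of the evolutions generated by finite partial sums of `k`. -/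
noncomputable def limitFlow (k : Region S → 𝒜) (t : ℝ) (A : 𝒜) : 𝒜 :=
  limUnder atTop fun R : Finset (Region S) => flow (∑ Z ∈ R, k Z) t A

/-- The elements localized in some finite region. -/
def localizedElements (k : Region S → 𝒜) : Set 𝒜 :=
  {A | ∃ X : Finset S, LocalizedIn k X A}

namespace IsShortRange

theorem cauchySeq_flow_of_nonneg (h : IsShortRange k κ) {X : Finset S} {A : 𝒜}
    (hA : LocalizedIn k X A) {t : ℝ} (ht : 0 ≤ t) :
    CauchySeq fun R : Finset (Region S) => flow (∑ Z ∈ R, k Z) t A := by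
  classical
  rcases X.eq_empty_or_nonempty with rfl | hX
  · have : (fun R : Finset (Region S) => flow (∑ Z ∈ R, k Z) t A) = fun _ => A := by
      funext R
      exact flow_of_commute (Commute.sum_left _ _ _ fun Z _ => hA Z (Finset.disjoint_empty_right _)) t
    rw [this]
    exact cauchySeq_const A
  · refine Metric.cauchySeq_iff'.2 fun ε hε => ?_
    -- The order `n` is fixed first, so that the factorial term is below `ε / 2`; the threshold `R₀`
    -- for that order follows.
    have hlim : Tendsto (fun n : ℕ => ‖A‖ * (2 * X.card * ((2 * κ * t) ^ n / n.factorial)))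
        atTop (𝓝 (‖A‖ * (2 * X.card * 0))) :=
      ((FloorSemiring.tendsto_pow_div_factorial_atTop (2 * κ * t)).const_mul _).const_mul _
    simp only [mul_zero] at hlim
    obtain ⟨n, hn⟩ := (hlim.eventually (gt_mem_nhds (half_pos hε))).exists
    obtain ⟨R₀, hR₀⟩ := h.flow_sub_flow_le ht n ⟨X, hX⟩ (ε / (2 * (‖A‖ + 1))) (by positivity)
    refine ⟨R₀, fun R hR => ?_⟩
    rw [dist_eq_norm]
    refine (hR₀ R₀ R subset_rfl hR t ⟨ht, le_rfl⟩ A hA).trans_lt ?_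
    have h1 : ‖A‖ * (ε / (2 * (‖A‖ + 1))) ≤ ε / 2 := by
      rw [← mul_div_assoc, div_le_div_iff₀ (by positivity) (by positivity)]
      nlinarith [norm_nonneg A]
    rw [mul_add]
    have h2 : 2 * (X.card : ℝ) * (2 * κ * t) ^ n / n.factorial
        = 2 * X.card * ((2 * κ * t) ^ n / n.factorial) := by ring
    rw [h2]
    linarith

/-- Negative times are positive times for the interaction `-k`. -/
theorem cauchySeq_flow_of_localized (h : IsShortRange k κ) {X : Finset S} {A : 𝒜}
    (hA : LocalizedIn k X A) (t : ℝ) :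
    CauchySeq fun R : Finset (Region S) => flow (∑ Z ∈ R, k Z) t A := by
  rcases le_total 0 t with ht | ht
  · exact h.cauchySeq_flow_of_nonneg hA ht
  · have := h.neg.cauchySeq_flow_of_nonneg (X := X) (A := A)
      (fun Z hZ => (hA Z hZ).neg_left) (neg_nonneg.2 ht)
    simpa only [Finset.sum_neg_distrib, flow_neg_time, neg_neg] using this

theorem norm_flow_sub_flow_of_sub_le (h : IsShortRange k κ) (R R' : Finset (Region S)) (t : ℝ)
    (A B : 𝒜) :
    ‖flow (∑ Z ∈ R, k Z) t A - flow (∑ Z ∈ R', k Z) t A‖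
      ≤ 2 * ‖A - B‖ + ‖flow (∑ Z ∈ R, k Z) t B - flow (∑ Z ∈ R', k Z) t B‖ := by
  have e : flow (∑ Z ∈ R, k Z) t A - flow (∑ Z ∈ R', k Z) t A
      = flow (∑ Z ∈ R, k Z) t (A - B) - flow (∑ Z ∈ R', k Z) t (A - B)
        + (flow (∑ Z ∈ R, k Z) t B - flow (∑ Z ∈ R', k Z) t B) := by
    rw [flow_sub_right, flow_sub_right]
    abel
  rw [e]
  refine (norm_add_le _ _).trans ?_
  have := norm_sub_le (flow (∑ Z ∈ R, k Z) t (A - B)) (flow (∑ Z ∈ R', k Z) t (A - B))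
  rw [norm_flow (h.star_sum R), norm_flow (h.star_sum R')] at this
  linarith

theorem cauchySeq_flow (h : IsShortRange k κ) (hd : Dense (localizedElements k)) (t : ℝ) (A : 𝒜) :
    CauchySeq fun R : Finset (Region S) => flow (∑ Z ∈ R, k Z) t A := by
  classical
  refine Metric.cauchySeq_iff'.2 fun ε hε => ?_
  obtain ⟨B, ⟨X, hB⟩, hAB⟩ := hd.exists_dist_lt A (show 0 < ε / 4 by positivity)
  obtain ⟨R₀, hR₀⟩ := Metric.cauchySeq_iff'.1 (h.cauchySeq_flow_of_localized hB t) (ε / 2)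
    (by positivity)
  refine ⟨R₀, fun R hR => ?_⟩
  have h1 := h.norm_flow_sub_flow_of_sub_le R R₀ t A B
  have h2 := hR₀ R hR
  rw [dist_eq_norm] at hAB h2 ⊢
  linarith

theorem tendsto_flow (h : IsShortRange k κ) (hd : Dense (localizedElements k)) (t : ℝ) (A : 𝒜) :
    Tendsto (fun R : Finset (Region S) => flow (∑ Z ∈ R, k Z) t A) atTop
      (𝓝 (limitFlow k t A)) := by
  classical
  exact (h.cauchySeq_flow hd t A).tendsto_limUnder

theorem limitFlow_unique (h : IsShortRange k κ) (hd : Dense (localizedElements k)) {t : ℝ}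
    {A B : 𝒜} (hB : Tendsto (fun R : Finset (Region S) => flow (∑ Z ∈ R, k Z) t A) atTop (𝓝 B)) :
    limitFlow k t A = B := by
  classical
  exact tendsto_nhds_unique (h.tendsto_flow hd t A) hB

theorem norm_limitFlow (h : IsShortRange k κ) (hd : Dense (localizedElements k)) (t : ℝ) (A : 𝒜) :
    ‖limitFlow k t A‖ = ‖A‖ := by
  classical
  refine tendsto_nhds_unique (h.tendsto_flow hd t A).norm ?_
  simp only [norm_flow (h.star_sum _)]
  exact tendsto_const_nhds

theorem limitFlow_zero (h : IsShortRange k κ) (hd : Dense (localizedElements k)) (A : 𝒜) :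
    limitFlow k 0 A = A :=
  h.limitFlow_unique hd (by simpa only [flow_zero] using tendsto_const_nhds)

theorem limitFlow_add (h : IsShortRange k κ) (hd : Dense (localizedElements k)) (t : ℝ)
    (A B : 𝒜) : limitFlow k t (A + B) = limitFlow k t A + limitFlow k t B :=
  h.limitFlow_unique hd (by
    simpa only [flow_add_right] using (h.tendsto_flow hd t A).add (h.tendsto_flow hd t B))

theorem limitFlow_sub (h : IsShortRange k κ) (hd : Dense (localizedElements k)) (t : ℝ)
    (A B : 𝒜) : limitFlow k t (A - B) = limitFlow k t A - limitFlow k t B :=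
  h.limitFlow_unique hd (by
    simpa only [flow_sub_right] using (h.tendsto_flow hd t A).sub (h.tendsto_flow hd t B))

theorem limitFlow_mul (h : IsShortRange k κ) (hd : Dense (localizedElements k)) (t : ℝ)
    (A B : 𝒜) : limitFlow k t (A * B) = limitFlow k t A * limitFlow k t B :=
  h.limitFlow_unique hd (by
    simpa only [flow_mul] using (h.tendsto_flow hd t A).mul (h.tendsto_flow hd t B))

theorem limitFlow_smul (h : IsShortRange k κ) (hd : Dense (localizedElements k)) (t : ℝ) (c : ℂ)
    (A : 𝒜) : limitFlow k t (c • A) = c • limitFlow k t A :=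
  h.limitFlow_unique hd (by
    simpa only [flow_smul] using (h.tendsto_flow hd t A).const_smul c)

theorem limitFlow_star (h : IsShortRange k κ) (hd : Dense (localizedElements k)) (t : ℝ) (A : 𝒜) :
    limitFlow k t (star A) = star (limitFlow k t A) :=
  h.limitFlow_unique hd (by
    simpa only [flow_star (h.star_sum _)] using (h.tendsto_flow hd t A).star)

/-- Finite-volume evolutions are isometric, so replacing the inner evolved element by its limit
costs no more than the distance to that limit, uniformly in the volume. -/
theorem limitFlow_add_time (h : IsShortRange k κ) (hd : Dense (localizedElements k)) (s t : ℝ)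
    (A : 𝒜) : limitFlow k (s + t) A = limitFlow k s (limitFlow k t A) := by
  refine h.limitFlow_unique hd ?_
  have h1 := h.tendsto_flow hd s (limitFlow k t A)
  refine h1.congr_dist ?_
  have h2 := tendsto_iff_dist_tendsto_zero.1 (h.tendsto_flow hd t A)
  refine h2.congr fun R => ?_
  rw [flow_add_time, dist_eq_norm, dist_comm, dist_eq_norm, ← flow_sub_right,
    norm_flow (h.star_sum R)]

/-- The infinite-volume evolution as a `*`-automorphism. -/
noncomputable def automorphism (h : IsShortRange k κ) (hd : Dense (localizedElements k)) (t : ℝ) :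
    𝒜 ≃⋆ₐ[ℂ] 𝒜 where
  toFun := limitFlow k t
  invFun := limitFlow k (-t)
  left_inv A := by rw [← h.limitFlow_add_time hd, neg_add_cancel, h.limitFlow_zero hd]
  right_inv A := by rw [← h.limitFlow_add_time hd, add_neg_cancel, h.limitFlow_zero hd]
  map_mul' := h.limitFlow_mul hd t
  map_add' := h.limitFlow_add hd t
  map_star' := h.limitFlow_star hd t
  map_smul' := h.limitFlow_smul hd t

theorem norm_limitFlow_sub_self_le (h : IsShortRange k κ) (hd : Dense (localizedElements k))
    {X : Finset S} {A : 𝒜} (hA : LocalizedIn k X A) (t : ℝ) :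
    ‖limitFlow k t A - A‖ ≤ 2 * (X.card * κ) * ‖A‖ * |t| := by
  classical
  refine le_of_tendsto ((h.tendsto_flow hd t A).sub_const A).norm (Eventually.of_forall fun R => ?_)
  refine (norm_flow_sub_self_le (h.star_sum R) t A).trans ?_
  gcongr
  exact h.norm_commutator_le hA R

theorem continuous_limitFlow (h : IsShortRange k κ) (hd : Dense (localizedElements k)) (A : 𝒜) :
    Continuous fun t => limitFlow k t A := by
  refine Metric.continuous_iff.2 fun s ε hε => ?_
  obtain ⟨B, ⟨X, hB⟩, hAB⟩ := hd.exists_dist_lt A (show 0 < ε / 4 by positivity)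
  set C := |2 * (X.card * κ) * ‖B‖| with hC
  have hC0 : 0 ≤ C := abs_nonneg _
  refine ⟨ε / (2 * (C + 1)), by positivity, fun t ht => ?_⟩
  -- The group law reduces continuity at `s` to small times; there the localized approximation `B`
  -- moves at bounded speed and `A - B` stays small.
  have e : limitFlow k t A - limitFlow k s A = limitFlow k s
      (limitFlow k (t - s) (A - B) - (A - B) + (limitFlow k (t - s) B - B)) := by
    have e1 : limitFlow k t A = limitFlow k s (limitFlow k (t - s) A) := by
      rw [← h.limitFlow_add_time hd, add_sub_cancel]
    rw [e1, ← h.limitFlow_sub hd s, h.limitFlow_sub hd (t - s) A B]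
    congr 1
    abel
  rw [dist_eq_norm, e, h.norm_limitFlow hd]
  refine (norm_add_le _ _).trans_lt ?_
  have h1 := norm_sub_le (limitFlow k (t - s) (A - B)) (A - B)
  rw [h.norm_limitFlow hd] at h1
  have h2 := h.norm_limitFlow_sub_self_le hd hB (t - s)
  have h3 : 2 * (X.card * κ) * ‖B‖ * |t - s| ≤ C * (ε / (2 * (C + 1))) := by
    rw [Real.dist_eq] at ht
    gcongr
    exact le_abs_self _
  have h4 : C * (ε / (2 * (C + 1))) ≤ ε / 2 := by
    rw [← mul_div_assoc, div_le_div_iff₀ (by positivity) (by positivity)]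
    nlinarith
  rw [dist_eq_norm] at hAB
  linarith

open scoped Classical in
theorem summable_commutator (h : IsShortRange k κ) {X : Finset S} {A : 𝒜}
    (hA : LocalizedIn k X A) : Summable fun Z : Region S => k Z * A - A * k Z := by
  refine Summable.of_norm_bounded ((h.summable_meeting X).mul_left (2 * ‖A‖)) fun Z => ?_
  split_ifs with hZ
  · rw [(hA Z hZ).eq, sub_self, norm_zero, mul_zero]
  · refine (_root_.norm_commutator_le _ _).trans (le_of_eq ?_)
    ring

theorem tendsto_commutator (h : IsShortRange k κ) {X : Finset S} {A : 𝒜}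
    (hA : LocalizedIn k X A) :
    Tendsto (fun R : Finset (Region S) => (∑ Z ∈ R, k Z) * A - A * ∑ Z ∈ R, k Z) atTop
      (𝓝 (∑' Z : Region S, (k Z * A - A * k Z))) := by
  have : Tendsto (fun R : Finset (Region S) => ∑ Z ∈ R, (k Z * A - A * k Z)) atTop
      (𝓝 (∑' Z : Region S, (k Z * A - A * k Z))) := (h.summable_commutator hA).hasSum
  refine this.congr fun R => ?_
  rw [Finset.sum_sub_distrib, Finset.sum_mul, Finset.mul_sum]

/-- Differentiability of the limit needs a remainder uniform in `R`. The commutator with `A` need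
not be localized uniformly in `R`, so it is compared with a localized `B`, whose speed is bounded
independently of `R`. -/
theorem norm_flow_sub_taylor_le (h : IsShortRange k κ) {Y : Finset S} (A : 𝒜) {B : 𝒜}
    (hB : LocalizedIn k Y B) (R : Finset (Region S)) (t : ℝ) :
    ‖flow (∑ Z ∈ R, k Z) t A - A - t • ((∑ Z ∈ R, k Z) * A - A * ∑ Z ∈ R, k Z)‖
      ≤ (2 * ‖((∑ Z ∈ R, k Z) * A - A * ∑ Z ∈ R, k Z) - B‖
        + |2 * (Y.card * κ) * ‖B‖| * |t|) * |t| := by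
  set K := ∑ Z ∈ R, k Z with hK
  set D := K * A - A * K with hD
  have hd : ∀ u, HasDerivAt (fun u : ℝ => flow K u A - A - u • D) (flow K u D - D) u := by
    intro u
    have h2 : HasDerivAt (fun u : ℝ => u • D) D u := by
      simpa using (hasDerivAt_id u).smul_const D
    exact ((hasDerivAt_flow K A u).sub_const A).sub h2
  have hbound : ∀ u ∈ Set.uIcc 0 t, ‖flow K u D - D‖
      ≤ 2 * ‖D - B‖ + |2 * (Y.card * κ) * ‖B‖| * |t| := by
    intro u hu
    have hut : |u| ≤ |t| := by simpa using Set.abs_sub_left_of_mem_uIcc hu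
    have e : flow K u D - D = flow K u (D - B) - (D - B) + (flow K u B - B) := by
      rw [flow_sub_right K u D B]
      abel
    rw [e]
    refine (norm_add_le _ _).trans ?_
    have h1 := norm_sub_le (flow K u (D - B)) (D - B)
    rw [norm_flow (h.star_sum R)] at h1
    have h2 := norm_flow_sub_self_le (h.star_sum R) u B
    have h3 : ‖K * B - B * K‖ * |u| ≤ |2 * (Y.card * κ) * ‖B‖| * |t| := by
      gcongr
      exact (h.norm_commutator_le hB R).trans (le_abs_self _)
    linarith
  have := Convex.norm_image_sub_le_of_norm_hasDerivWithin_le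
    (f := fun u : ℝ => flow K u A - A - u • D)
    (fun u _ => (hd u).hasDerivWithinAt) hbound (convex_uIcc 0 t)
    Set.left_mem_uIcc Set.right_mem_uIcc
  simpa [flow_zero] using this

/-- Localized elements are in the domain of the generator of the infinite-volume evolution. -/
theorem hasDerivAt_limitFlow (h : IsShortRange k κ) (hd : Dense (localizedElements k))
    {X : Finset S} {A : 𝒜} (hA : LocalizedIn k X A) :
    HasDerivAt (fun t => limitFlow k t A) (∑' Z : Region S, (k Z * A - A * k Z)) 0 := by
  classical
  set D := ∑' Z : Region S, (k Z * A - A * k Z) with hD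
  have hlim := h.tendsto_commutator hA
  -- The uniform Taylor bound passes to the limit over `R`, with `B` fixed. Choosing `B` close to
  -- `D` afterwards makes the remainder `o(t)`.
  have key : ∀ (Y : Finset S) (B : 𝒜), LocalizedIn k Y B → ∀ t : ℝ,
      ‖limitFlow k t A - A - t • D‖ ≤ (2 * ‖D - B‖ + |2 * (Y.card * κ) * ‖B‖| * |t|) * |t| := by
    intro Y B hB t
    refine le_of_tendsto_of_tendsto (((h.tendsto_flow hd t A).sub_const A).sub
      (hlim.const_smul t)).norm ((((hlim.sub_const B).norm.const_mul 2).add_const _).mul_const _)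
      (Eventually.of_forall fun R => h.norm_flow_sub_taylor_le A hB R t)
  rw [hasDerivAt_iff_isLittleO, Asymptotics.isLittleO_iff]
  intro ε hε
  obtain ⟨B, ⟨Y, hB⟩, hDB⟩ := hd.exists_dist_lt D (show 0 < ε / 4 by positivity)
  set C := |2 * (Y.card * κ) * ‖B‖| with hC
  have hC0 : 0 ≤ C := abs_nonneg _
  filter_upwards [Metric.ball_mem_nhds (0 : ℝ) (show 0 < ε / (2 * (C + 1)) by positivity)]
    with t ht
  rw [mem_ball_zero_iff, Real.norm_eq_abs] at ht
  rw [sub_zero, h.limitFlow_zero hd, Real.norm_eq_abs]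
  refine (key Y B hB t).trans ?_
  gcongr
  have h3 : C * |t| ≤ C * (ε / (2 * (C + 1))) := by gcongr
  have h4 : C * (ε / (2 * (C + 1))) ≤ ε / 2 := by
    rw [← mul_div_assoc, div_le_div_iff₀ (by positivity) (by positivity)]
    nlinarith
  rw [dist_eq_norm] at hDB
  linarith

end IsShortRange

end InfiniteVolume

/-! ### Matrix units and commutation of operators on disjoint regions -/

section MatrixUnits

variable {S : Type*} (ι : S → Type*) [∀ x, Finite (ι x)]

/-- The elements of the quasi-local algebra form a C⋆-algebra. -/
noncomputable instance QuasiLocal.instCStarAlgebra : CStarAlgebra (QuasiLocal ι) :=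
  StarSubalgebra.cstarAlgebra (quasiLocalAlgebra ι)
    (h_closed := StarSubalgebra.isClosed_topologicalClosure _)

open scoped Classical in
/-- The matrix unit `|α⟩⟨β| ⊗ 𝟙` on the finite set `Λ`. -/
noncomputable def unitOp (Λ : Finset S) (α β : ∀ x, ι x) :
    ConfigHilbert ι →L[ℂ] ConfigHilbert ι :=
  localEmbed ι Λ (ContinuousLinearMap.smulRight
    (EuclideanSpace.proj (splitConfig ι Λ β).1)
    (EuclideanSpace.single (splitConfig ι Λ α).1 1))

open scoped Classical in
theorem unitOp_apply (Λ : Finset S) (α β : ∀ x, ι x) (ψ : ConfigHilbert ι) (σ : ∀ x, ι x) :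
    unitOp ι Λ α β ψ σ = if ∀ x ∈ Λ, σ x = α x then ψ (Λ.piecewise β σ) else 0 := by
  have h1 : (splitConfig ι Λ).symm ((splitConfig ι Λ β).1, (splitConfig ι Λ σ).2)
      = Λ.piecewise β σ := by
    funext x
    change (if hx : x ∈ Λ then β x else σ x) = _
    by_cases hx : x ∈ Λ <;> simp [hx]
  have h2 : (splitConfig ι Λ σ).1 = (splitConfig ι Λ α).1 ↔ ∀ x ∈ Λ, σ x = α x :=
    ⟨fun h x hx => congrFun h ⟨x, hx⟩, fun h => funext fun x => h x.1 x.2⟩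
  change (slice ι Λ ψ (splitConfig ι Λ σ).2 (splitConfig ι Λ β).1 •
    (EuclideanSpace.single (splitConfig ι Λ α).1 (1 : ℂ)) : LocalHilbert ι Λ)
      (splitConfig ι Λ σ).1 = _
  rw [PiLp.smul_apply, PiLp.single_apply]
  simp only [h2]
  split_ifs
  · rw [← h1]
    simp [slice]
  · simp

theorem regionAlgebra_le_span [∀ x, Nonempty (ι x)] (Λ : Finset S)
    {T : ConfigHilbert ι →L[ℂ] ConfigHilbert ι}
    (hT : T ∈ regionAlgebra ι Λ) :
    T ∈ Submodule.span ℂ (Set.range fun p : (∀ x, ι x) × (∀ x, ι x) => unitOp ι Λ p.1 p.2) := by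
  classical
  obtain ⟨A, rfl⟩ := hT
  -- Matrix units are labelled by global configurations, so local labels are extended arbitrarily.
  have ext : ∀ τ : LocalConfig ι Λ, ∃ α : ∀ x, ι x, (splitConfig ι Λ α).1 = τ := fun τ =>
    ⟨(splitConfig ι Λ).symm (τ, fun _ => Classical.arbitrary _), by simp⟩
  choose e he using ext
  have hA : A = ∑ τ, ∑ τ', (A (EuclideanSpace.single τ' 1) τ) •
      ContinuousLinearMap.smulRight (EuclideanSpace.proj τ' : LocalHilbert ι Λ →L[ℂ] ℂ)
        (EuclideanSpace.single τ 1) := by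
    ext v σ
    have hv : v = ∑ τ', v τ' • EuclideanSpace.single τ' (1 : ℂ) := by
      ext ρ
      simp [Pi.single_apply]
    conv_lhs => rw [hv]
    simp only [map_sum, map_smul, WithLp.ofLp_sum, Finset.sum_apply, PiLp.smul_apply, smul_eq_mul,
      _root_.sum_apply, _root_.smul_apply,
      ContinuousLinearMap.smulRight_apply, PiLp.proj_apply, PiLp.single_apply]
    rw [Finset.sum_comm]
    simp [mul_comm]
  rw [show (localEmbed ι Λ).toRingHom A = localEmbed ι Λ A from rfl, hA, map_sum]
  refine Submodule.sum_mem _ fun τ _ => ?_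
  rw [map_sum]
  refine Submodule.sum_mem _ fun τ' _ => ?_
  rw [map_smul]
  refine Submodule.smul_mem _ _ (Submodule.subset_span ⟨(e τ, e τ'), ?_⟩)
  simp only [unitOp, he]

theorem commute_of_commute_unitOp [∀ x, Nonempty (ι x)] {Λ : Finset S}
    {T A : ConfigHilbert ι →L[ℂ] ConfigHilbert ι} (hT : ∀ α β, Commute T (unitOp ι Λ α β))
    (hA : A ∈ regionAlgebra ι Λ) : Commute T A := by
  refine Submodule.span_induction ?_ (Commute.zero_right T) (fun _ _ _ _ h h' => h.add_right h')
    (fun c _ _ h => h.smul_right c) (regionAlgebra_le_span ι Λ hA)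
  rintro _ ⟨p, rfl⟩
  exact hT p.1 p.2

/-- Each operator tests and overwrites the configuration on its own region only, so the order is
immaterial when the regions are disjoint. -/
theorem commute_unitOp {Λ Λ' : Finset S} (h : Disjoint Λ Λ') (α β α' β' : ∀ x, ι x) :
    Commute (unitOp ι Λ α β) (unitOp ι Λ' α' β') := by
  classical
  refine ContinuousLinearMap.ext fun ψ => ?_
  ext σ
  have hn : ∀ x ∈ Λ, x ∉ Λ' := fun x hx => Finset.disjoint_left.1 h hx
  have hn' : ∀ x ∈ Λ', x ∉ Λ := fun x hx => Finset.disjoint_right.1 h hx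
  change unitOp ι Λ α β (unitOp ι Λ' α' β' ψ) σ = unitOp ι Λ' α' β' (unitOp ι Λ α β ψ) σ
  simp only [unitOp_apply]
  have e1 : (∀ x ∈ Λ', Λ.piecewise β σ x = α' x) ↔ ∀ x ∈ Λ', σ x = α' x :=
    forall₂_congr fun x hx => by rw [Finset.piecewise_eq_of_notMem _ _ _ (hn' x hx)]
  have e2 : (∀ x ∈ Λ, Λ'.piecewise β' σ x = α x) ↔ ∀ x ∈ Λ, σ x = α x :=
    forall₂_congr fun x hx => by rw [Finset.piecewise_eq_of_notMem _ _ _ (hn x hx)]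
  have e3 : Λ'.piecewise β' (Λ.piecewise β σ) = Λ.piecewise β (Λ'.piecewise β' σ) := by
    funext x
    by_cases hx : x ∈ Λ
    · simp [hx, hn x hx]
    · by_cases hx' : x ∈ Λ' <;> simp [hx, hx']
  simp only [e1, e2, e3]
  split_ifs <;> rfl

theorem unitOp_empty (α β : ∀ x, ι x) : unitOp ι ∅ α β = 1 := by
  classical
  refine ContinuousLinearMap.ext fun ψ => ?_
  ext σ
  simp [unitOp_apply]

open scoped Classical in
theorem unitOp_insert {Λ : Finset S} {z : S} (hz : z ∉ Λ) (α β : ∀ x, ι x) :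
    unitOp ι (insert z Λ) α β = unitOp ι {z} α β * unitOp ι Λ α β := by
  refine ContinuousLinearMap.ext fun ψ => ?_
  ext σ
  change _ = unitOp ι {z} α β (unitOp ι Λ α β ψ) σ
  simp only [unitOp_apply, Finset.mem_singleton, forall_eq, Finset.forall_mem_insert]
  have e1 : (∀ x ∈ Λ, ({z} : Finset S).piecewise β σ x = α x) ↔ ∀ x ∈ Λ, σ x = α x :=
    forall₂_congr fun x hx => by
      rw [Finset.piecewise_eq_of_notMem]
      rw [Finset.mem_singleton]
      rintro rfl
      exact hz hx
  have e2 : Λ.piecewise β (({z} : Finset S).piecewise β σ) = (insert z Λ).piecewise β σ := by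
    funext x
    by_cases hx : x ∈ Λ
    · simp [hx]
    · by_cases hx' : x = z
      · subst hx'
        simp [hx]
      · simp [hx, hx']
  simp only [e1, e2, ite_and]

/-- Matrix units of a region are products of one-site matrix units, so commutation can be checked
site by site. -/
theorem commute_unitOp_of_singleton {Λ : Finset S} {T : ConfigHilbert ι →L[ℂ] ConfigHilbert ι}
    (h : ∀ z ∈ Λ, ∀ α β, Commute T (unitOp ι {z} α β)) (α β : ∀ x, ι x) :
    Commute T (unitOp ι Λ α β) := by
  classical
  induction Λ using Finset.induction_on with
  | empty => rw [unitOp_empty]; exact Commute.one_right T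
  | insert z Λ hz ih =>
    rw [unitOp_insert ι hz]
    exact (h z (Finset.mem_insert_self _ _) α β).mul_right
      (ih fun y hy => h y (Finset.mem_insert_of_mem hy))

theorem commute_of_disjoint [∀ x, Nonempty (ι x)] {Λ Λ' : Finset S} (h : Disjoint Λ Λ')
    {A B : ConfigHilbert ι →L[ℂ] ConfigHilbert ι} (hA : A ∈ regionAlgebra ι Λ)
    (hB : B ∈ regionAlgebra ι Λ') : Commute A B :=
  commute_of_commute_unitOp ι (fun α β => (commute_of_commute_unitOp ι
    (fun α' β' => commute_unitOp ι h.symm α β α' β') hA).symm) hB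

end MatrixUnits

/-! ### Local operators in the quasi-local algebra -/

section LocalOperators

variable {S : Type*} {ι : S → Type*} [∀ x, Finite (ι x)]

theorem InRegion.mono {A : QuasiLocal ι} {Λ Λ' : Finset S} (hA : InRegion A Λ) (h : Λ ⊆ Λ') :
    InRegion A Λ' :=
  regionAlgebra_mono ι h hA

theorem IsLocalOperator.exists_inRegion {A : QuasiLocal ι} (hA : IsLocalOperator A) :
    ∃ Λ, InRegion A Λ :=
  (mem_localAlgebra ι).1 hA

theorem dense_isLocalOperator : Dense {A : QuasiLocal ι | IsLocalOperator A} := by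
  intro A
  rw [Topology.IsInducing.subtypeVal.closure_eq_preimage_closure_image]
  refine closure_mono ?_ A.2
  intro T hT
  exact ⟨⟨T, StarSubalgebra.le_topologicalClosure _ hT⟩, hT, rfl⟩

variable [∀ x, Nonempty (ι x)]

theorem InRegion.commute {A B : QuasiLocal ι} {Λ Λ' : Finset S} (hA : InRegion A Λ)
    (hB : InRegion B Λ') (h : Disjoint Λ Λ') : Commute A B :=
  Subtype.ext (commute_of_disjoint ι h hA hB)

/-- An operator commutes with the operators of the regions which do not meet its support. -/
theorem InRegion.commute_of_disjoint_support {A B : QuasiLocal ι} {Λ : Finset S}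
    (hB : InRegion B Λ) (h : Disjoint (operatorSupport A) Λ) :
    Commute A B := by
  refine Subtype.ext (commute_of_commute_unitOp ι (fun α β =>
    commute_unitOp_of_singleton ι (fun z hz α β => ?_) α β) hB)
  -- The support is an intersection of regions, and `A` is not known here to lie in the algebra of
  -- that intersection. For each single site `z` outside it, however, some region of `A` avoids `z`,
  -- which suffices.
  have hzA : z ∉ operatorSupport A := fun hzA => Set.disjoint_left.1 h hzA hz
  simp only [operatorSupport, Set.mem_ofPred_eq, not_forall] at hzA
  obtain ⟨Λ', hΛ', hzΛ'⟩ := hzA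
  exact commute_of_disjoint ι (Finset.disjoint_singleton_right.2 hzΛ') hΛ' ⟨_, rfl⟩

/-- The exponential may be taken in the finite-dimensional matrix algebra, as the embedding is a
continuous homomorphism. -/
theorem InRegion.exp {A : QuasiLocal ι} {Λ : Finset S} (hA : InRegion A Λ) :
    InRegion (NormedSpace.exp A) Λ := by
  let : NormedAlgebra ℚ (QuasiLocal ι) := NormedAlgebra.restrictScalars ℚ ℝ _
  let : NormedAlgebra ℚ (LocalHilbert ι Λ →L[ℂ] LocalHilbert ι Λ) :=
    NormedAlgebra.restrictScalars ℚ ℂ _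
  obtain ⟨B, hB⟩ := hA
  have hc : Continuous (localEmbed ι Λ) :=
    (AddMonoidHomClass.isometry_of_norm (localEmbed ι Λ) (norm_localEmbed ι Λ)).continuous
  have h1 : ((NormedSpace.exp A : QuasiLocal ι) : ConfigHilbert ι →L[ℂ] ConfigHilbert ι)
      = NormedSpace.exp (A : ConfigHilbert ι →L[ℂ] ConfigHilbert ι) :=
    NormedSpace.map_exp (quasiLocalAlgebra ι).subtype continuous_subtype_val A
  refine ⟨NormedSpace.exp B, ?_⟩
  rw [h1, ← hB]
  exact NormedSpace.map_exp (localEmbed ι Λ) hc B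

end LocalOperators

/-! ### The generator on unitaries as a sum of second differences -/

section Generator

open NormedSpace Filter Topology

variable {S : Type*} {𝒜 : Type*} [CStarAlgebra 𝒜] {k : Region S → 𝒜} {κ : ℝ}

/-- The exponential factors off `C`, and conjugation by it fixes `A`. This is what permits changing
the generator by symmetries and by distant charges. -/
theorem flow_add_left_of_commute {K C A : 𝒜} (hKC : Commute K C) (hA : Commute C A) (t : ℝ) :
    flow (K + C) t A = flow K t A := by
  let : NormedAlgebra ℚ 𝒜 := NormedAlgebra.restrictScalars ℚ ℝ 𝒜
  have h : Commute (t • K) (t • C) := (hKC.smul_left t).smul_right t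
  have e : exp (-(t • (K + C))) = exp (-(t • C)) * exp (-(t • K)) := by
    rw [← exp_add_of_commute h.symm.neg_left.neg_right, smul_add, neg_add, add_comm]
  have h2 := flow_of_commute hA t
  rw [flow] at h2
  simp only [flow]
  rw [e, smul_add, exp_add_of_commute h]
  calc _ = exp (t • K) * (exp (t • C) * A * exp (-(t • C))) * exp (-(t • K)) := by
        simp only [mul_assoc]
    _ = _ := by rw [h2]

/-- For unitary `U`, `U (kU* - U*k) = UkU* - k`, and likewise with `U` and `U*` exchanged. The sum
is the second difference of the conjugation, for each finite `R` and then in the limit. -/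
theorem IsShortRange.norm_generator_le (h : IsShortRange k κ) {X : Finset S} {K : 𝒜}
    (hK : star K = -K) (s : ℝ) (hU : LocalizedIn k X (exp (s • K)))
    (hU' : LocalizedIn k X (star (exp (s • K)))) {C : ℝ}
    (hC : ∀ R : Finset (Region S),
      ∑ Z ∈ R, ‖flow K s (k Z) + flow K (-s) (k Z) - (2 : ℝ) • k Z‖ ≤ C) :
    ‖exp (s • K) * (∑' Z, (k Z * star (exp (s • K)) - star (exp (s • K)) * k Z))
      + star (exp (s • K)) * (∑' Z, (k Z * exp (s • K) - exp (s • K) * k Z))‖ ≤ C := by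
  classical
  have hlim := ((h.tendsto_commutator hU').const_mul (exp (s • K))).add
    ((h.tendsto_commutator hU).const_mul (star (exp (s • K))))
  refine le_of_tendsto hlim.norm (Eventually.of_forall fun R => ?_)
  refine le_trans (le_of_eq ?_) ((norm_sum_le _ _).trans (hC R))
  congr 1
  rw [Finset.sum_sub_distrib, Finset.sum_add_distrib, ← flow_sum, ← flow_sum, ← Finset.smul_sum,
    two_smul, star_exp_skew (star_smul_skew hK s), flow_neg_time]
  simp only [flow, smul_neg, neg_neg, mul_sub, ← mul_assoc, exp_mul_exp_neg, exp_neg_mul_exp,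
    one_mul]
  abel

end Generator

/-! ### Counting points and summing decay over `L` -/

section EffectiveDimension

variable {d : ℕ} {L : Set (EuclideanSpace ℝ (Fin d))} {γ : ℝ}

theorem HasEffectiveDimension.exists_count (hL : HasEffectiveDimension L γ) :
    ∃ C : ℝ, 0 ≤ C ∧ ∃ r₀ : ℝ, 0 ≤ r₀ ∧ ∀ r : ℝ, r₀ ≤ r → ∀ z : L, ∃ F : Finset L,
      (∀ y, y ∈ F ↔ dist z y < r) ∧ (F.card : ℝ) ≤ C * r ^ γ := by
  obtain ⟨C, hC, r₀, hr₀, h⟩ := hL.growth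
  refine ⟨C, hC, r₀, hr₀, fun r hr z => ?_⟩
  obtain ⟨hfin, hcard⟩ := h r hr z z.2
  have himg : (fun y : L => (y : EuclideanSpace ℝ (Fin d))) '' {y : L | dist z y < r}
      = Metric.ball (z : EuclideanSpace ℝ (Fin d)) r ∩ L := by
    ext y
    constructor
    · rintro ⟨w, hw, rfl⟩
      exact ⟨by rw [Metric.mem_ball, dist_comm]; exact hw, w.2⟩
    · rintro ⟨hy, hyL⟩
      exact ⟨⟨y, hyL⟩, by rw [Metric.mem_ball, dist_comm] at hy; exact hy, rfl⟩
  rw [← himg] at hfin hcard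
  have hf : {y : L | dist z y < r}.Finite := hfin.of_finite_image Subtype.val_injective.injOn
  refine ⟨hf.toFinset, fun y => by simp, ?_⟩
  rwa [Set.ncard_image_of_injective _ Subtype.val_injective,
    Set.ncard_eq_toFinset_card _ hf] at hcard

/-- Points are grouped by integer radii. Counting whole balls instead of shells, the radius `n + 1`
contributes `(n + 1)^γ (n + 1)^(-(γ + 1 + ε))`, which is summable: this is where the extra power in
the pair decay is used. -/
theorem HasEffectiveDimension.exists_tsum_le (hL : HasEffectiveDimension L γ) {ε : ℝ}
    (hε : 0 < ε) : ∃ K : ℝ≥0∞, K < ⊤ ∧ ∀ x : L,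
      ∑' y : L, ENNReal.ofReal ((1 + dist x y) ^ (-(γ + 1 + ε))) ≤ K := by
  classical
  obtain ⟨C, hC, r₀, hr₀, h⟩ := hL.exists_count
  have hγ := hL.pos
  have hsum : Summable fun n : ℕ => C * (1 + r₀) ^ γ * ((n : ℝ) + 1) ^ (-(1 + ε)) := by
    refine Summable.mul_left _ ?_
    have := (summable_nat_add_iff 1).2 (Real.summable_nat_rpow.2 (show -(1 + ε) < -1 by linarith))
    simpa using this
  refine ⟨∑' n : ℕ, ENNReal.ofReal (C * (1 + r₀) ^ γ * ((n : ℝ) + 1) ^ (-(1 + ε))),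
    hsum.tsum_ofReal_lt_top, fun x => ?_⟩
  have h1 : ∀ y : L, ENNReal.ofReal ((1 + dist x y) ^ (-(γ + 1 + ε))) ≤ ∑' n : ℕ,
      if dist x y < n + 1 then ENNReal.ofReal (((n : ℝ) + 1) ^ (-(γ + 1 + ε))) else 0 := by
    intro y
    refine le_trans ?_ (ENNReal.le_tsum ⌊dist x y⌋₊)
    rw [if_pos (Nat.lt_floor_add_one _)]
    refine ENNReal.ofReal_le_ofReal ?_
    rw [add_comm]
    refine Real.rpow_le_rpow_of_nonpos (by positivity) ?_ (by linarith)
    gcongr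
    exact Nat.floor_le dist_nonneg
  refine (ENNReal.tsum_le_tsum h1).trans ?_
  rw [ENNReal.tsum_comm]
  refine ENNReal.tsum_le_tsum fun n => ?_
  -- The radius is enlarged by `r₀` because the count holds only from `r₀` on.
  obtain ⟨F, hF, hcard⟩ := h (n + 1 + r₀)
    (by linarith [(Nat.cast_nonneg n : (0 : ℝ) ≤ n)]) x
  rw [tsum_eq_sum (s := F) fun y hy => if_neg fun hlt => hy ((hF y).2 (by linarith))]
  refine (Finset.sum_le_sum fun y _ => (ite_le_sup _ _ _).trans (sup_le le_rfl zero_le)).trans ?_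
  rw [Finset.sum_const, nsmul_eq_mul, ← ENNReal.ofReal_natCast, ← ENNReal.ofReal_mul (by positivity)]
  refine ENNReal.ofReal_le_ofReal ?_
  have hn : (0 : ℝ) < n + 1 := by positivity
  have h2 : ((n : ℝ) + 1 + r₀) ^ γ ≤ (1 + r₀) ^ γ * ((n : ℝ) + 1) ^ γ := by
    rw [← Real.mul_rpow (by positivity) hn.le]
    refine Real.rpow_le_rpow (by positivity) ?_ hγ.le
    nlinarith [(Nat.cast_nonneg n : (0 : ℝ) ≤ n)]
  calc (F.card : ℝ) * ((n : ℝ) + 1) ^ (-(γ + 1 + ε))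
      ≤ (C * ((1 + r₀) ^ γ * ((n : ℝ) + 1) ^ γ)) * ((n : ℝ) + 1) ^ (-(γ + 1 + ε)) := by
        gcongr
        exact hcard.trans (by gcongr)
    _ = C * (1 + r₀) ^ γ * (((n : ℝ) + 1) ^ γ * ((n : ℝ) + 1) ^ (-(γ + 1 + ε))) := by ring
    _ = _ := by
        rw [← Real.rpow_add hn]
        congr 2
        ring

end EffectiveDimension

/-! ### Pair decay implies short range -/

section Lattice

open Filter Topology

variable {d : ℕ} {L : Set (EuclideanSpace ℝ (Fin d))} {γ : ℝ} {ι : L → Type*}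
  [∀ x, Finite (ι x)]

open scoped Classical in
-- The weight `|Z|` is the number of `y ∈ Z`. Exchanging the sums leaves, for each `y`, the sum over
-- `Z` containing both `x` and `y`, which pair decay bounds by a function of `|x - y|` summable over
-- `L`.
theorem PairDecay.exists_sum_le {φ : Region L → QuasiLocal ι} (hφ : PairDecay φ γ)
    (hL : HasEffectiveDimension L γ) : ∃ κ : ℝ, ∀ (x : L) (R : Finset (Region L)),
      ∑ Z ∈ R with x ∈ Z.1, (Z.1.card : ℝ) * ‖φ Z‖ ≤ κ := by
  obtain ⟨ε, hε, hD⟩ := hφ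
  obtain ⟨K, hK, hKx⟩ := hL.exists_tsum_le hε
  set D := ⨆ x : L, ⨆ y : L, ENNReal.ofReal ((1 + dist x y) ^ (γ + 1 + ε)) *
    ∑' Λ : {Λ : Region L // x ∈ Λ.1 ∧ y ∈ Λ.1}, ‖φ Λ.1‖ₑ with hDdef
  refine ⟨(D * K).toReal, fun x R => ?_⟩
  rw [← ENNReal.ofReal_le_iff_le_toReal (ENNReal.mul_lt_top hD hK).ne]
  have hpair : ∀ y : L, ∑ Z ∈ R with x ∈ Z.1, (if y ∈ Z.1 then ‖φ Z‖ₑ else 0)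
      ≤ D * ENNReal.ofReal ((1 + dist x y) ^ (-(γ + 1 + ε))) := by
    intro y
    have h1 : ∑ Z ∈ R with x ∈ Z.1, (if y ∈ Z.1 then ‖φ Z‖ₑ else 0)
        ≤ ∑' Λ : {Λ : Region L // x ∈ Λ.1 ∧ y ∈ Λ.1}, ‖φ Λ.1‖ₑ := by
      rw [← Finset.sum_filter, Finset.filter_filter, ← Finset.sum_subtype_eq_sum_filter]
      exact ENNReal.sum_le_tsum _
    have h2 : ENNReal.ofReal ((1 + dist x y) ^ (γ + 1 + ε)) *
        ∑' Λ : {Λ : Region L // x ∈ Λ.1 ∧ y ∈ Λ.1}, ‖φ Λ.1‖ₑ ≤ D :=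
      le_iSup₂_of_le x y le_rfl
    have hpos : (0 : ℝ) < 1 + dist x y := by positivity
    have h3 : ENNReal.ofReal ((1 + dist x y) ^ (-(γ + 1 + ε))) *
        ENNReal.ofReal ((1 + dist x y) ^ (γ + 1 + ε)) = 1 := by
      rw [← ENNReal.ofReal_mul (by positivity), ← Real.rpow_add hpos, neg_add_cancel,
        Real.rpow_zero, ENNReal.ofReal_one]
    refine h1.trans ?_
    rw [mul_comm D]
    calc _ = ENNReal.ofReal ((1 + dist x y) ^ (-(γ + 1 + ε))) *
          (ENNReal.ofReal ((1 + dist x y) ^ (γ + 1 + ε)) *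
            ∑' Λ : {Λ : Region L // x ∈ Λ.1 ∧ y ∈ Λ.1}, ‖φ Λ.1‖ₑ) := by
          rw [← mul_assoc, h3, one_mul]
      _ ≤ _ := by gcongr
  calc ENNReal.ofReal (∑ Z ∈ R with x ∈ Z.1, (Z.1.card : ℝ) * ‖φ Z‖)
      = ∑ Z ∈ R with x ∈ Z.1, ∑' y : L, (if y ∈ Z.1 then ‖φ Z‖ₑ else 0) := by
        rw [ENNReal.ofReal_sum_of_nonneg fun Z _ => by positivity]
        refine Finset.sum_congr rfl fun Z _ => ?_
        rw [tsum_eq_sum (s := Z.1) fun y hy => if_neg hy,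
          Finset.sum_congr rfl fun y hy => if_pos hy, Finset.sum_const, nsmul_eq_mul,
          ENNReal.ofReal_mul (by positivity), ENNReal.ofReal_natCast, ofReal_norm]
    _ = ∑' y : L, ∑ Z ∈ R with x ∈ Z.1, (if y ∈ Z.1 then ‖φ Z‖ₑ else 0) :=
        (Summable.tsum_finsetSum fun _ _ => ENNReal.summable).symm
    _ ≤ ∑' y : L, D * ENNReal.ofReal ((1 + dist x y) ^ (-(γ + 1 + ε))) :=
        ENNReal.tsum_le_tsum hpair
    _ ≤ D * K := by
        rw [ENNReal.tsum_mul_left]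
        gcongr
        exact hKx x

end Lattice

/-! ### The time evolution induced by an interaction -/

section SpinDynamics

open Filter Topology

variable {S : Type*} {ι : S → Type*} [∀ x, Finite (ι x)]

theorem localEvolution_eq_flow (φ : Region S → QuasiLocal ι) (Λ : Finset S) (t : ℝ)
    (A : QuasiLocal ι) : localEvolution φ Λ t A =
      flow (∑ Z ∈ Λ.powerset.subtype Finset.Nonempty, Complex.I • φ Z) t A := by
  have e : (Complex.I * t) • localHamiltonian φ Λ
      = t • ∑ Z ∈ Λ.powerset.subtype Finset.Nonempty, Complex.I • φ Z := by
    rw [localHamiltonian, ← Finset.smul_sum, mul_comm, mul_smul, Complex.coe_smul]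
  rw [localEvolution, flow, neg_smul, e]

/-- Every finite set of regions is eventually contained in the regions inside `Λ j`, so convergence
along the net of finite sets of regions gives convergence along each exhausting sequence. -/
theorem tendsto_regions {Λ : ℕ → Finset S} (hΛ : Monotone Λ) (hex : ∀ x, ∃ j, x ∈ Λ j) :
    Tendsto (fun j => (Λ j).powerset.subtype Finset.Nonempty) atTop atTop := by
  refine tendsto_atTop_finset_of_monotone (fun i j hij Z hZ => ?_) fun Z => ?_
  · simp only [Finset.mem_subtype, Finset.mem_powerset] at hZ ⊢
    exact hZ.trans (hΛ hij)
  · obtain ⟨j, hj⟩ := ((tendsto_atTop_finset_of_monotone hΛ hex).eventually_ge_atTop Z.1).exists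
    exact ⟨j, by simpa using hj⟩

theorem IsShortRange.isTimeEvolution {k : Region S → QuasiLocal ι} {κ : ℝ}
    (h : IsShortRange k κ) (hd : Dense (localizedElements k)) :
    IsTimeEvolution (h.automorphism hd) where
  zero := h.limitFlow_zero hd
  add := h.limitFlow_add_time hd
  continuous := h.continuous_limitFlow hd

theorem IsShortRange.isInducedBy {φ : Region S → QuasiLocal ι} {κ : ℝ}
    (h : IsShortRange (fun Z => Complex.I • φ Z) κ)
    (hd : Dense (localizedElements fun Z => Complex.I • φ Z)) :
    IsInducedBy (h.automorphism hd) φ := by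
  intro Λ hΛ hex t A
  refine ((h.tendsto_flow hd t A).comp (tendsto_regions hΛ hex)).congr fun j => ?_
  exact (localEvolution_eq_flow φ (Λ j) t A).symm

variable [∀ x, Nonempty (ι x)]

theorem IsInteraction.localizedIn {φ : Region S → QuasiLocal ι} (hφ : IsInteraction φ)
    {A : QuasiLocal ι} {X : Finset S} (hA : InRegion A X) :
    LocalizedIn (fun Z => Complex.I • φ Z) X A := fun Z hZ =>
  ((hφ.inRegion Z).commute hA hZ).smul_left Complex.I

open scoped Classical in
theorem IsInteraction.isShortRange {φ : Region S → QuasiLocal ι} (hφ : IsInteraction φ) {κ : ℝ}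
    (hκ : ∀ (x : S) (R : Finset (Region S)), ∑ Z ∈ R with x ∈ Z.1, (Z.1.card : ℝ) * ‖φ Z‖ ≤ κ) :
    IsShortRange (fun Z => Complex.I • φ Z) κ where
  skew Z := by rw [star_smul, (hφ.selfAdjoint Z).star_eq]; simp
  localized Z := fun W hW => (hφ.localizedIn (hφ.inRegion Z) W hW).smul_right Complex.I
  sum_le x R := by simpa only [norm_smul, Complex.norm_I, one_mul] using hκ x R

theorem IsInteraction.dense_localizedElements {φ : Region S → QuasiLocal ι}
    (hφ : IsInteraction φ) : Dense (localizedElements fun Z => Complex.I • φ Z) :=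
  dense_isLocalOperator.mono fun _ hA =>
    let ⟨X, hX⟩ := IsLocalOperator.exists_inRegion hA
    ⟨X, hφ.localizedIn hX⟩

end SpinDynamics

/-! ### Uniform Taylor approximation of truncated monomials -/

section Taylor

/-- Induction on the order, integrating the expansion of the derivative, which is again smooth with
compact support. Compact support bounds all derivatives, so the constant does not depend on the base
point. -/
theorem exists_taylor_coefficients (N : ℕ) : ∀ {h : ℝ → ℝ},
    ContDiff ℝ ((⊤ : ℕ∞) : WithTop ℕ∞) h → HasCompactSupport h →
    ∃ C : ℝ, 0 ≤ C ∧ ∀ u₀ : ℝ, ∃ c : ℕ → ℝ, (∀ l, |c l| ≤ C) ∧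
      ∀ u, |h u - ∑ l ∈ Finset.range N, c l * (u - u₀) ^ l| ≤ C * |u - u₀| ^ N := by
  induction N with
  | zero =>
    intro h hs hc
    obtain ⟨C, hC⟩ := hs.continuous.bounded_above_of_compact_support hc
    refine ⟨C, (norm_nonneg _).trans (hC 0), fun u₀ => ⟨fun _ => 0, fun l => ?_, fun u => ?_⟩⟩
    · simpa using (norm_nonneg _).trans (hC 0)
    · simpa using hC u
  | succ N ih =>
    intro h hs hc
    obtain ⟨C₀, hC₀⟩ := hs.continuous.bounded_above_of_compact_support hc
    have hC₀0 : 0 ≤ C₀ := (norm_nonneg _).trans (hC₀ 0)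
    obtain ⟨hdiff, hs'⟩ := contDiff_infty_iff_deriv.1 hs
    obtain ⟨C, hC0, hC⟩ := ih hs' hc.deriv
    refine ⟨C₀ + C, by positivity, fun u₀ => ?_⟩
    obtain ⟨c, hc1, hc2⟩ := hC u₀
    refine ⟨fun l => Nat.casesOn l (h u₀) fun l => c l / (l + 1), fun l => ?_, fun u => ?_⟩
    · cases l with
      | zero =>
        have := hC₀ u₀
        rw [Real.norm_eq_abs] at this
        change |h u₀| ≤ _
        linarith
      | succ l =>
        change |c l / (l + 1)| ≤ _
        rw [abs_div, abs_of_pos (show (0 : ℝ) < l + 1 by positivity)]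
        have : |c l| / ((l : ℝ) + 1) ≤ |c l| :=
          div_le_self (abs_nonneg _) (by linarith [(Nat.cast_nonneg l : (0 : ℝ) ≤ l)])
        linarith [hc1 l]
    · have hd : ∀ v, HasDerivAt (fun v => h v - (∑ l ∈ Finset.range N,
          c l / (l + 1) * (v - u₀) ^ (l + 1)) - h u₀)
          (deriv h v - ∑ l ∈ Finset.range N, c l * (v - u₀) ^ l) v := by
        intro v
        refine (((hdiff v).hasDerivAt).sub (HasDerivAt.fun_sum fun l _ => ?_)).sub_const _
        have h1 := ((((hasDerivAt_id v).sub_const u₀).pow (l + 1)).const_mul (c l / (l + 1)))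
        refine h1.congr_deriv ?_
        have : (l : ℝ) + 1 ≠ 0 := by positivity
        simp
        field_simp
      have hbound : ∀ v ∈ Set.uIcc u₀ u,
          ‖deriv h v - ∑ l ∈ Finset.range N, c l * (v - u₀) ^ l‖ ≤ C * |u - u₀| ^ N := by
        intro v hv
        refine (hc2 v).trans ?_
        exact mul_le_mul_of_nonneg_left
          (pow_le_pow_left₀ (abs_nonneg _) (Set.abs_sub_left_of_mem_uIcc hv) N) hC0
      have := Convex.norm_image_sub_le_of_norm_hasDerivWithin_le
        (fun v _ => (hd v).hasDerivWithinAt) hbound (convex_uIcc u₀ u)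
        Set.left_mem_uIcc Set.right_mem_uIcc
      rw [Finset.sum_range_succ']
      simp only [Real.norm_eq_abs, sub_self, ne_eq, Nat.add_eq_zero_iff, one_ne_zero, and_false,
        not_false_eq_true, zero_pow, mul_zero, Finset.sum_const_zero, sub_zero] at this
      simp only [pow_zero, mul_one]
      rw [← sub_sub]
      refine this.trans ?_
      rw [mul_assoc, ← pow_succ]
      gcongr
      linarith

variable {d : ℕ}

/-- The polynomials of degree less than `N` in the variables `x_j`, `j ∈ J`. -/
def polynomialsBelow (J : Finset (Fin d)) (N : ℕ) :
    Submodule ℝ (EuclideanSpace ℝ (Fin d) → ℝ) :=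
  Submodule.span ℝ {f | ∃ b : Fin d → ℕ, ∑ j, b j < N ∧ (∀ j ∉ J, b j = 0) ∧ f = multiPow b}

theorem polynomialsBelow_mono {J J' : Finset (Fin d)} {N N' : ℕ} (hJ : J ⊆ J') (hN : N ≤ N') :
    polynomialsBelow J N ≤ polynomialsBelow J' N' := by
  refine Submodule.span_mono ?_
  rintro _ ⟨b, hb, hbJ, rfl⟩
  exact ⟨b, by omega, fun j hj => hbJ j fun h => hj (hJ h), rfl⟩

theorem multiPow_add (b b' : Fin d → ℕ) :
    (multiPow (b + b') : EuclideanSpace ℝ (Fin d) → ℝ) = multiPow b * multiPow b' := by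
  funext x
  simp [multiPow, pow_add, Finset.prod_mul_distrib]

theorem multiPow_smul (b : Fin d → ℕ) (c : ℝ) (x : EuclideanSpace ℝ (Fin d)) :
    multiPow b (c • x) = c ^ (∑ j, b j) * multiPow b x := by
  simp [multiPow, mul_pow, Finset.prod_mul_distrib, Finset.prod_pow_eq_pow_sum]

/-- Degree bounds are strict: degree at most `M` times degree below `N` is below `M + N`. -/
theorem polynomialsBelow_mul {J : Finset (Fin d)} {M N : ℕ} {f g : EuclideanSpace ℝ (Fin d) → ℝ}
    (hf : f ∈ polynomialsBelow J (M + 1)) (hg : g ∈ polynomialsBelow J N) :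
    f * g ∈ polynomialsBelow J (M + N) := by
  have := Submodule.mul_mem_mul hf hg
  rw [polynomialsBelow, polynomialsBelow, Submodule.span_mul_span] at this
  refine Submodule.span_mono ?_ this
  rintro _ ⟨_, ⟨b, hb, hbJ, rfl⟩, _, ⟨b', hb', hbJ', rfl⟩, rfl⟩
  refine ⟨b + b', ?_, fun j hj => ?_, (multiPow_add b b').symm⟩
  · simp only [Pi.add_apply, Finset.sum_add_distrib]
    omega
  · rw [Pi.add_apply, hbJ j hj, hbJ' j hj]

theorem const_mem_polynomialsBelow (J : Finset (Fin d)) {N : ℕ} (hN : 0 < N) (c : ℝ) :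
    (fun _ => c) ∈ polynomialsBelow J N := by
  have h : multiPow 0 ∈ polynomialsBelow J N :=
    Submodule.subset_span ⟨0, by simpa using hN, fun _ _ => rfl, rfl⟩
  have e : (fun _ => c) = c • (multiPow 0 : EuclideanSpace ℝ (Fin d) → ℝ) := by
    funext x
    simp [multiPow]
  rw [e]
  exact Submodule.smul_mem _ c h

theorem coord_sub_pow_mem_polynomialsBelow {J : Finset (Fin d)} {i : Fin d} (hi : i ∈ J) (c : ℝ)
    (l : ℕ) : (fun x : EuclideanSpace ℝ (Fin d) => (x i - c) ^ l) ∈ polynomialsBelow J (l + 1) := by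
  classical
  induction l with
  | zero => simpa using const_mem_polynomialsBelow J zero_lt_one 1
  | succ l ih =>
    have h1 : (fun x : EuclideanSpace ℝ (Fin d) => x i - c) ∈ polynomialsBelow J (1 + 1) := by
      refine Submodule.sub_mem (x := fun x : EuclideanSpace ℝ (Fin d) => x i) (y := fun _ => c) _
        (Submodule.subset_span ⟨Pi.single i 1, ?_, fun j hj => ?_, ?_⟩)
        (const_mem_polynomialsBelow J (by norm_num) c)
      · simp
      · rw [Pi.single_apply, if_neg]
        rintro rfl
        exact hj hi
      · funext x
        simp [multiPow, Pi.single_apply, pow_ite]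
    have := polynomialsBelow_mul h1 ih
    rw [show l + 1 + 1 = 1 + (l + 1) by omega]
    convert this using 1
    funext x
    simp [pow_succ, mul_comm]

theorem comp_smul_mem_polynomialsBelow {J : Finset (Fin d)} {N : ℕ}
    {f : EuclideanSpace ℝ (Fin d) → ℝ} (hf : f ∈ polynomialsBelow J N) (c : ℝ) :
    (fun x => f (c • x)) ∈ polynomialsBelow J N := by
  refine Submodule.span_induction (p := fun f _ => (fun x => f (c • x)) ∈ polynomialsBelow J N)
    ?_ (Submodule.zero_mem _) (fun _ _ _ _ h h' => Submodule.add_mem _ h h')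
    (fun r _ _ h => Submodule.smul_mem _ r h) hf
  rintro _ ⟨b, hb, hbJ, rfl⟩
  have e : (fun x => multiPow b (c • x))
      = c ^ (∑ j, b j) • (multiPow b : EuclideanSpace ℝ (Fin d) → ℝ) := by
    funext x
    exact multiPow_smul b c x
  rw [e]
  exact Submodule.smul_mem _ _ (Submodule.subset_span ⟨b, hb, hbJ, rfl⟩)

theorem abs_coord_le_norm (x : EuclideanSpace ℝ (Fin d)) (i : Fin d) : |x i| ≤ ‖x‖ := by
  simpa using PiLp.norm_apply_le x i

/-- Taylor approximation, uniform in the base point, of a product of test functions of the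
coordinates. -/
theorem exists_taylor_prod {h : Fin d → ℝ → ℝ}
    (hs : ∀ j, ContDiff ℝ ((⊤ : ℕ∞) : WithTop ℕ∞) (h j)) (hc : ∀ j, HasCompactSupport (h j))
    (J : Finset (Fin d)) : ∀ N : ℕ, ∃ C : ℝ, 0 ≤ C ∧ ∀ x₀ : EuclideanSpace ℝ (Fin d),
      ∃ P ∈ polynomialsBelow J N, ∀ x, |∏ j ∈ J, h j (x j) - P x| ≤ C * ‖x - x₀‖ ^ N := by
  classical
  induction J using Finset.induction_on with
  | empty =>
    intro N
    refine ⟨1, zero_le_one, fun x₀ => ?_⟩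
    rcases N.eq_zero_or_pos with rfl | hN
    · exact ⟨0, Submodule.zero_mem _, fun x => by simp⟩
    · exact ⟨fun _ => 1, const_mem_polynomialsBelow _ hN 1, fun x => by
        simp only [Finset.prod_empty, sub_self, abs_zero]
        positivity⟩
  | insert i J hi ih =>
    intro N
    obtain ⟨C₁, hC₁, h1⟩ := exists_taylor_coefficients N (hs i) (hc i)
    -- At order zero the only polynomial is `0`, so this is a uniform bound on the product of the
    -- remaining factors.
    obtain ⟨C₀, hC₀, h0⟩ := ih 0
    -- Next to the `l`-th power of the new coordinate, the other factors need expanding only to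
    -- order `N - l`; this keeps the total degree below `N`.
    choose C₂ hC₂ h2 using fun l => ih (N - l)
    refine ⟨C₁ * C₀ + ∑ l ∈ Finset.range N, C₁ * C₂ l,
      add_nonneg (by positivity) (Finset.sum_nonneg fun l _ => mul_nonneg hC₁ (hC₂ l)),
      fun x₀ => ?_⟩
    obtain ⟨c, hcC, hcu⟩ := h1 (x₀ i)
    choose P hP hPx using fun l => h2 l x₀
    have hG : ∀ x : EuclideanSpace ℝ (Fin d), |∏ j ∈ J, h j (x j)| ≤ C₀ := fun x => by
      obtain ⟨P, hP, hPx⟩ := h0 x₀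
      have hP0 : P = 0 := by simpa [polynomialsBelow] using hP
      simpa [hP0] using hPx x
    refine ⟨∑ l ∈ Finset.range N, c l • ((fun x => (x i - x₀ i) ^ l) * P l),
      Submodule.sum_mem _ fun l hl => Submodule.smul_mem _ _ ?_, fun x => ?_⟩
    · have hl' := Finset.mem_range.1 hl
      have := polynomialsBelow_mul
        (coord_sub_pow_mem_polynomialsBelow (Finset.mem_insert_self i J) (x₀ i) l)
        (polynomialsBelow_mono (Finset.subset_insert i J) le_rfl (hP l))
      rwa [show l + (N - l) = N by omega] at this
    · set G := ∏ j ∈ J, h j (x j) with hGdef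
      have hv : |x i - x₀ i| ≤ ‖x - x₀‖ := by simpa using abs_coord_le_norm (x - x₀) i
      have e : ∏ j ∈ insert i J, h j (x j)
          - (∑ l ∈ Finset.range N, c l •
            ((fun x : EuclideanSpace ℝ (Fin d) => (x i - x₀ i) ^ l) * P l)) x
          = (h i (x i) - ∑ l ∈ Finset.range N, c l * (x i - x₀ i) ^ l) * G
            + ∑ l ∈ Finset.range N, c l * (x i - x₀ i) ^ l * (G - P l x) := by
        rw [Finset.prod_insert hi, ← hGdef]
        simp only [Finset.sum_apply, Pi.smul_apply, Pi.mul_apply, smul_eq_mul, mul_sub, sub_mul,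
          Finset.sum_sub_distrib, Finset.sum_mul, mul_assoc]
        ring
      rw [e, add_mul, Finset.sum_mul]
      refine (abs_add_le _ _).trans (add_le_add ?_ ((Finset.abs_sum_le_sum_abs _ _).trans
        (Finset.sum_le_sum fun l hl => ?_)))
      · rw [abs_mul]
        calc _ ≤ C₁ * |x i - x₀ i| ^ N * C₀ := by
              gcongr
              exacts [hcu _, hG x]
          _ ≤ C₁ * ‖x - x₀‖ ^ N * C₀ := by gcongr
          _ = _ := by ring
      · have hl' := Finset.mem_range.1 hl
        rw [abs_mul, abs_mul, abs_pow]
        calc _ ≤ C₁ * ‖x - x₀‖ ^ l * (C₂ l * ‖x - x₀‖ ^ (N - l)) := by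
              gcongr
              exacts [hcC l, hPx l x]
          _ = C₁ * C₂ l * (‖x - x₀‖ ^ l * ‖x - x₀‖ ^ (N - l)) := by ring
          _ = _ := by rw [← pow_add, show l + (N - l) = N by omega]

theorem IsCutoff.hasCompactSupport {χ : ℝ → ℝ} (hχ : IsCutoff χ) : HasCompactSupport χ := by
  refine HasCompactSupport.intro (isCompact_Icc (a := -2) (b := 2)) fun u hu => hχ.eq_zero u ?_
  by_contra hlt
  rw [not_le, abs_lt] at hlt
  exact hu ⟨hlt.1.le, hlt.2.le⟩

/-- The truncated monomials `χ_m(x) x ^ a` have Taylor approximations of degree `k` with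
remainders of order `m ^ (|a| - k - 1)`. -/
theorem IsCutoff.exists_taylor {χ : ℝ → ℝ} (hχ : IsCutoff χ) {a : Fin d → ℕ}
    {J : Finset (Fin d)} (ha : ∀ j ∉ J, a j = 0) (N : ℕ) :
    ∃ C : ℝ, 0 ≤ C ∧ ∀ m : ℕ, 1 ≤ m → ∀ x₀ : EuclideanSpace ℝ (Fin d),
      ∃ P ∈ polynomialsBelow J N, ∀ x : EuclideanSpace ℝ (Fin d), (∀ j ∉ J, χ (x j / m) = 1) →
        |boxCutoff χ m x * multiPow a x - P x|
          ≤ C * ((m : ℝ) ^ (∑ j, a j) / (m : ℝ) ^ N) * ‖x - x₀‖ ^ N := by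
  -- Scaling: the truncated monomial is `m^|a|` times a fixed product of test functions at `x / m`.
  -- Expanding that product at `x₀ / m` gives a constant independent of `m` and the factor `m^(|a| -
  -- N)`.
  obtain ⟨C, hC0, hC⟩ := exists_taylor_prod (h := fun j u => χ u * u ^ a j)
    (fun j => hχ.smooth.mul (contDiff_id.pow _)) (fun j => hχ.hasCompactSupport.mul_right) J N
  refine ⟨C, hC0, fun m hm x₀ => ?_⟩
  have hm0 : (0 : ℝ) < m := by exact_mod_cast hm
  obtain ⟨P, hP, hPx⟩ := hC ((m : ℝ)⁻¹ • x₀)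
  refine ⟨(m : ℝ) ^ (∑ j, a j) • fun x => P ((m : ℝ)⁻¹ • x),
    Submodule.smul_mem _ _ (comp_smul_mem_polynomialsBelow hP _), fun x hx => ?_⟩
  have e : boxCutoff χ m x * multiPow a x
      = (m : ℝ) ^ (∑ j, a j) * ∏ j ∈ J, (χ (((m : ℝ)⁻¹ • x) j) * ((m : ℝ)⁻¹ • x) j ^ a j) := by
    rw [Finset.prod_subset (Finset.subset_univ J) fun j _ hj => ?_,
      ← Finset.prod_pow_eq_pow_sum, ← Finset.prod_mul_distrib, boxCutoff, multiPow,
      ← Finset.prod_mul_distrib]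
    · refine Finset.prod_congr rfl fun j _ => ?_
      simp only [PiLp.smul_apply, smul_eq_mul, mul_pow, inv_pow]
      rw [inv_mul_eq_div]
      have : (m : ℝ) ^ a j ≠ 0 := by positivity
      field_simp
    · rw [ha j hj, pow_zero, mul_one, PiLp.smul_apply, smul_eq_mul, inv_mul_eq_div]
      exact hx j hj
  have h1 := hPx ((m : ℝ)⁻¹ • x)
  rw [← smul_sub, norm_smul, norm_inv, Real.norm_natCast, mul_pow, inv_pow] at h1
  rw [e, Pi.smul_apply, smul_eq_mul, ← mul_sub, abs_mul, abs_of_pos (by positivity)]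
  calc _ ≤ (m : ℝ) ^ (∑ j, a j) * (C * (((m : ℝ) ^ N)⁻¹ * ‖x - x₀‖ ^ N)) := by gcongr
    _ = _ := by ring

end Taylor

/-! ### Charges, multipole invariance and second differences -/

section Charges

variable {d : ℕ} {L : Set (EuclideanSpace ℝ (Fin d))} {γ : ℝ} {ι : L → Type*}
  [∀ x, Finite (ι x)]

theorem commute_of_flow_eq {𝒜 : Type*} [CStarAlgebra 𝒜] {K A : 𝒜} (h : ∀ t, flow K t A = A) :
    Commute K A := by
  have h1 := hasDerivAt_flow K A 0
  simp only [h, flow_zero] at h1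
  exact sub_eq_zero.1 (h1.unique (hasDerivAt_const 0 A))

theorem norm_le_of_abs_coord_le {v : EuclideanSpace ℝ (Fin d)} {r : ℝ} (hr : 0 ≤ r)
    (h : ∀ j, |v j| ≤ r) : ‖v‖ ≤ d * r := by
  refine abs_le_of_sq_le_sq' ?_ (by positivity) |>.2
  rw [EuclideanSpace.norm_sq_eq]
  have h1 : ∑ j, ‖v j‖ ^ 2 ≤ d * r ^ 2 := by
    refine (Finset.sum_le_sum (g := fun _ => r ^ 2) fun j _ => ?_).trans (by simp)
    rw [Real.norm_eq_abs]
    gcongr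
    exact h j
  have h2 : (d : ℝ) ≤ (d : ℝ) ^ 2 := by exact_mod_cast Nat.le_self_pow (by norm_num) d
  rw [mul_pow]
  exact h1.trans (by gcongr)

/-- Growth is assumed only for balls around points of `L`, so the ball is centred at some point of
`L` in the box, if there is one. The box has diameter at most `2dr`; the extra `1` makes the
inequality strict and `r₀` makes the radius admissible. -/
theorem HasEffectiveDimension.exists_box (hL : HasEffectiveDimension L γ) :
    ∃ C : ℝ, 0 ≤ C ∧ ∀ r : ℝ, 1 ≤ r → ∃ F : Finset L,
      (∀ y, y ∈ F ↔ ∀ j, |(y : EuclideanSpace ℝ (Fin d)) j| ≤ r) ∧ (F.card : ℝ) ≤ C * r ^ γ := by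
  classical
  obtain ⟨C, hC, r₀, hr₀, h⟩ := hL.exists_count
  refine ⟨C * (2 * d + 1 + r₀) ^ γ, by positivity, fun r hr => ?_⟩
  by_cases hex : ∃ z : L, ∀ j, |(z : EuclideanSpace ℝ (Fin d)) j| ≤ r
  · obtain ⟨z, hz⟩ := hex
    obtain ⟨F, hF, hcard⟩ := h ((2 * d + 1 + r₀) * r)
      (by nlinarith [(Nat.cast_nonneg d : (0 : ℝ) ≤ d)]) z
    refine ⟨F.filter fun y => ∀ j, |(y : EuclideanSpace ℝ (Fin d)) j| ≤ r, fun y => ?_, ?_⟩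
    · rw [Finset.mem_filter, and_iff_right_iff_imp]
      intro hy
      rw [hF, Subtype.dist_eq, dist_eq_norm]
      have := norm_le_of_abs_coord_le (v := (z : EuclideanSpace ℝ (Fin d)) - (y : EuclideanSpace ℝ (Fin d)))
        (r := 2 * r) (by linarith) fun j => by
          have h1 := abs_sub ((z : EuclideanSpace ℝ (Fin d)) j) ((y : EuclideanSpace ℝ (Fin d)) j)
          have h2 := hz j
          have h3 := hy j
          simp only [PiLp.sub_apply]
          linarith
      nlinarith
    · refine le_trans (by exact_mod_cast Finset.card_filter_le _ _) (hcard.trans (le_of_eq ?_))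
      rw [Real.mul_rpow (by positivity) (by linarith), mul_assoc]
  · refine ⟨∅, fun y => ?_, ?_⟩
    · simpa using not_exists.1 hex y
    · simp only [Finset.card_empty, Nat.cast_zero]
      have : 0 ≤ r ^ γ := Real.rpow_nonneg (by linarith) _
      positivity

theorem IsChargeFamily.finite_chargesMeeting {n : L → QuasiLocal ι} (hn : IsChargeFamily n)
    (hL : HasEffectiveDimension L γ) (Λ : Finset L) : (chargesMeeting n Λ).Finite := by
  classical
  obtain ⟨R₀, hR₀, hsupp⟩ := hn.finiteRange
  obtain ⟨C, -, r₀, hr₀, h⟩ := hL.exists_count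
  choose F hF _ using fun y : L => h (r₀ + R₀) (by linarith) y
  refine (Λ.biUnion F).finite_toSet.subset ?_
  rintro z ⟨y, hy, hyΛ⟩
  refine Finset.mem_coe.2 (Finset.mem_biUnion.2 ⟨y, hyΛ, (hF y z).2 ?_⟩)
  have := Metric.mem_ball.1 (hsupp z hy)
  linarith

open scoped Classical in
theorem MomentDecay.exists_sum_le {n : L → QuasiLocal ι} {φ : Region L → QuasiLocal ι} {k : ℕ}
    (h : MomentDecay n φ k) (hfin : ∀ Λ : Finset L, (chargesMeeting n Λ).Finite) :
    ∃ K : ℝ, 0 ≤ K ∧ ∀ (x : L) (R : Finset (Region L)), ∑ Z ∈ R with x ∈ Z.1,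
      ‖φ Z‖ * (∑ z ∈ (hfin Z.1).toFinset, dist z x ^ (k + 1)) ^ 2 ≤ K := by
  refine ⟨_, ENNReal.toReal_nonneg, fun x R => (ENNReal.ofReal_le_iff_le_toReal h.ne).1 ?_⟩
  refine le_trans ?_ (le_iSup _ x)
  rw [← Finset.sum_subtype_eq_sum_filter, ENNReal.ofReal_sum_of_nonneg fun Z _ => by positivity]
  refine le_trans (Finset.sum_le_sum fun Z _ => le_of_eq ?_) (ENNReal.sum_le_tsum _)
  rw [ENNReal.ofReal_mul (norm_nonneg _), ofReal_norm, ENNReal.ofReal_pow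
    (Finset.sum_nonneg fun z _ => by positivity), ENNReal.ofReal_sum_of_nonneg
    fun z _ => by positivity]
  congr 2
  have := Finset.tsum_subtype' (hfin Z.1.1).toFinset fun z : L => edist z x ^ (k + 1)
  rw [(hfin Z.1.1).coe_toFinset] at this
  refine Eq.trans ?_ this.symm
  refine Finset.sum_congr rfl fun z _ => ?_
  rw [ENNReal.ofReal_pow dist_nonneg, edist_dist]

theorem commute_charge_of_notMem [∀ x, Nonempty (ι x)] {n : L → QuasiLocal ι}
    {φ : Region L → QuasiLocal ι} (hφ : IsInteraction φ) {z : L} {Z : Region L}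
    (h : z ∉ chargesMeeting n Z.1) : Commute (n z) (φ Z) :=
  (hφ.inRegion Z).commute_of_disjoint_support
    (Set.disjoint_iff_inter_eq_empty.2 (Set.not_nonempty_iff_eq_empty.1 h))

theorem IsMultipoleInvariant.commute_multipoleMoment {n : L → QuasiLocal ι}
    {φ : Region L → QuasiLocal ι} {b : Fin d → ℕ} (h : IsMultipoleInvariant n φ b)
    (Z : Region L) : Commute (multipoleMoment n b Z.1) (φ Z) := by
  have h1 : Commute (Complex.I • multipoleMoment n b Z.1) (φ Z) := by
    refine commute_of_flow_eq fun t => ?_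
    -- The symmetry has `exp(-is…)` on the left, hence the opposite time.
    have h2 := h Z (-t)
    have e : -(Complex.I * ((-t : ℝ) : ℂ)) • multipoleMoment n b Z.1
        = t • (Complex.I • multipoleMoment n b Z.1) := by
      rw [Complex.ofReal_neg, mul_neg, neg_neg, mul_comm, mul_smul, Complex.coe_smul]
    have e' : (Complex.I * ((-t : ℝ) : ℂ)) • multipoleMoment n b Z.1
        = -(t • (Complex.I • multipoleMoment n b Z.1)) := by
      rw [← e, neg_smul, neg_neg]
    rwa [multipoleSymmetry, e, e'] at h2
  have h3 := h1.smul_left (-Complex.I)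
  rwa [smul_smul, neg_mul, Complex.I_mul_I, neg_neg, one_smul] at h3

/-- The moment is linear in its coefficient function, so invariance under monomials extends to their
span. -/
theorem commute_polynomial_moment {n : L → QuasiLocal ι} {φ : Region L → QuasiLocal ι}
    {J : Finset (Fin d)} {k : ℕ} (hfin : ∀ Λ : Finset L, (chargesMeeting n Λ).Finite)
    (hinv : ∀ b : Fin d → ℕ, ∑ j, b j ≤ k → (∀ j ∉ J, b j = 0) → IsMultipoleInvariant n φ b)
    (Z : Region L) {P : EuclideanSpace ℝ (Fin d) → ℝ} (hP : P ∈ polynomialsBelow J (k + 1)) :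
    Commute (∑ z ∈ (hfin Z.1).toFinset, ((P z : ℝ) : ℂ) • n z) (φ Z) := by
  refine Submodule.span_induction
    (p := fun P _ => Commute (∑ z ∈ (hfin Z.1).toFinset, ((P z : ℝ) : ℂ) • n z) (φ Z))
    ?_ ?_ ?_ ?_ hP
  · rintro _ ⟨b, hb, hbJ, rfl⟩
    have := (hinv b (by omega) hbJ).commute_multipoleMoment Z
    rwa [multipoleMoment, finsum_mem_eq_finite_toFinset_sum _ (hfin Z.1)] at this
  · simp
  · intro P Q _ _ h h'
    simp only [Pi.add_apply, Complex.ofReal_add, add_smul, Finset.sum_add_distrib]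
    exact h.add_left h'
  · intro c P _ h
    simp only [Pi.smul_apply, smul_eq_mul, Complex.ofReal_mul, mul_smul, ← Finset.smul_sum]
    exact h.smul_left _

theorem IsChargeFamily.star_sum {n : L → QuasiLocal ι} (hn : IsChargeFamily n) (F : Finset L)
    (f : L → ℝ) : star (Complex.I • ∑ x ∈ F, (f x : ℂ) • n x)
      = -(Complex.I • ∑ x ∈ F, (f x : ℂ) • n x) := by
  rw [star_smul, _root_.star_sum]
  simp only [star_smul, (hn.selfAdjoint _).star_eq]
  simp

theorem IsChargeFamily.commute_sum {n : L → QuasiLocal ι} (hn : IsChargeFamily n)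
    (F G : Finset L) (f g : L → ℝ) :
    Commute (∑ x ∈ F, (f x : ℂ) • n x) (∑ x ∈ G, (g x : ℂ) • n x) :=
  Commute.sum_left _ _ _ fun x _ => Commute.sum_right _ _ _ fun y _ =>
    ((hn.commute x y).smul_left _).smul_right _

/-- Only the charges meeting `Z`, with their coefficients changed by a polynomial generating a
symmetry, contribute to the second difference of `φ(Z)`. -/
theorem norm_second_difference_le [∀ x, Nonempty (ι x)] {n : L → QuasiLocal ι}
    (hn : IsChargeFamily n) {φ : Region L → QuasiLocal ι} (hφ : IsInteraction φ)
    (hfin : ∀ Λ : Finset L, (chargesMeeting n Λ).Finite) {Z : Region L} {F : Finset L}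
    {f P : L → ℝ} (hf : ∀ x ∉ F, f x = 0)
    (hP : Commute (∑ z ∈ (hfin Z.1).toFinset, ((P z : ℝ) : ℂ) • n z) (φ Z)) {N₀ : ℝ}
    (hN₀ : ∀ x, ‖n x‖ ≤ N₀) (s : ℝ) :
    ‖flow (Complex.I • ∑ x ∈ F, (f x : ℂ) • n x) s (Complex.I • φ Z)
      + flow (Complex.I • ∑ x ∈ F, (f x : ℂ) • n x) (-s) (Complex.I • φ Z)
      - (2 : ℝ) • (Complex.I • φ Z)‖
      ≤ 8 * s ^ 2 * (N₀ * ∑ z ∈ (hfin Z.1).toFinset, |f z - P z|) ^ 2 * ‖φ Z‖ := by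
  classical
  set M := (hfin Z.1).toFinset with hM
  -- The generator splits into a remainder `Q₁`, a symmetry `Q₂` and charges `Q₃` away from `Z`. The
  -- last two commute with `φ(Z)` and, as charges commute, with `Q₁`, so they drop out.
  set Q₁ := ∑ z ∈ M, ((f z - P z : ℝ) : ℂ) • n z with hQ₁
  set Q₂ := ∑ z ∈ M, ((P z : ℝ) : ℂ) • n z with hQ₂
  set Q₃ := ∑ z ∈ F \ M, ((f z : ℝ) : ℂ) • n z with hQ₃
  have hsum : ∑ x ∈ F, (f x : ℂ) • n x = Q₁ + (Q₂ + Q₃) := by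
    have h1 : ∑ x ∈ F, (f x : ℂ) • n x = ∑ x ∈ F ∪ M, (f x : ℂ) • n x :=
      Finset.sum_subset Finset.subset_union_left fun x _ hx => by simp [hf x hx]
    rw [h1, ← Finset.sum_sdiff Finset.subset_union_right, Finset.union_sdiff_right, ← add_assoc,
      hQ₁, hQ₂, ← Finset.sum_add_distrib, add_comm]
    congr 1
    refine Finset.sum_congr rfl fun z _ => ?_
    rw [← add_smul, ← Complex.ofReal_add, sub_add_cancel]
  have h3 : Commute Q₃ (φ Z) := Commute.sum_left _ _ _ fun z hz =>
    (commute_charge_of_notMem hφ fun hz' =>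
      (Finset.mem_sdiff.1 hz).2 ((hfin Z.1).mem_toFinset.2 hz')).smul_left _
  have hC : Commute (Complex.I • (Q₂ + Q₃)) (Complex.I • φ Z) :=
    ((hP.add_left h3).smul_left _).smul_right _
  have hQC : Commute (Complex.I • Q₁) (Complex.I • (Q₂ + Q₃)) :=
    (((hn.commute_sum _ _ _ _).add_right (hn.commute_sum _ _ _ _)).smul_left _).smul_right _
  have hskew : star (Complex.I • Q₁) = -(Complex.I • Q₁) := hn.star_sum M fun z => f z - P z
  rw [hsum, smul_add, flow_add_left_of_commute hQC hC, flow_add_left_of_commute hQC hC]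
  refine (norm_flow_add_flow_neg_sub_le hskew s _).trans ?_
  simp only [norm_smul, Complex.norm_I, one_mul]
  gcongr
  rw [hQ₁, Finset.mul_sum]
  refine norm_sum_le_of_le _ fun z _ => ?_
  rw [norm_smul, Complex.norm_real, Real.norm_eq_abs, mul_comm]
  gcongr
  exact hN₀ z

theorem commute_sum_charges_of_forall_notMem [∀ x, Nonempty (ι x)] {n : L → QuasiLocal ι}
    {φ : Region L → QuasiLocal ι} (hφ : IsInteraction φ) {Z : Region L} {F : Finset L}
    (f : L → ℝ) (h : ∀ x ∈ F, x ∉ chargesMeeting n Z.1) :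
    Commute (∑ x ∈ F, (f x : ℂ) • n x) (φ Z) :=
  Commute.sum_left _ _ _ fun x hx => (commute_charge_of_notMem hφ (h x hx)).smul_left _

theorem IsChargeFamily.exists_inRegion_sum {n : L → QuasiLocal ι} (hn : IsChargeFamily n)
    (F : Finset L) (f : L → ℝ) :
    ∃ X, InRegion (∑ x ∈ F, (f x : ℂ) • n x) X := by
  classical
  choose X hX using fun x => IsLocalOperator.exists_inRegion (hn.isLocal x)
  refine ⟨F.biUnion X, ?_⟩
  rw [InRegion, AddSubmonoidClass.coe_finsetSum]
  exact sum_mem fun x hx => (regionAlgebra ι _).toSubalgebra.smul_mem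
    ((hX x).mono (Finset.subset_biUnion_of_mem X hx)) _

end Charges

/-! ### The uniform bound for the truncated unitaries -/

section MerminWagner

variable {d : ℕ} {L : Set (EuclideanSpace ℝ (Fin d))} {γ : ℝ} {ι : L → Type*}
  [∀ x, Finite (ι x)]

theorem IsCutoff.boxCutoff_eq_zero {χ : ℝ → ℝ} (hχ : IsCutoff χ) {m : ℕ} (hm : 1 ≤ m)
    {x : EuclideanSpace ℝ (Fin d)} {j : Fin d} (hj : 2 * m ≤ |x j|) : boxCutoff χ m x = 0 := by
  refine Finset.prod_eq_zero (Finset.mem_univ j) (hχ.eq_zero _ ?_)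
  have hm0 : (0 : ℝ) < m := by exact_mod_cast hm
  rwa [abs_div, abs_of_pos hm0, le_div_iff₀ hm0]

/-- The truncated monomial `χ_m(x) x ^ a`. -/
noncomputable def truncatedMonomial (χ : ℝ → ℝ) (a : Fin d → ℕ) (m : ℕ) (x : L) : ℝ :=
  boxCutoff χ m (x : EuclideanSpace ℝ (Fin d)) * multiPow a (x : EuclideanSpace ℝ (Fin d))

/-- The truncated moment `∑ χ_m(x) x ^ a n_x`. -/
noncomputable def truncatedMoment (n : L → QuasiLocal ι) (χ : ℝ → ℝ) (a : Fin d → ℕ) (m : ℕ) :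
    QuasiLocal ι :=
  ∑ᶠ x : L, (truncatedMonomial χ a m x : ℂ) • n x

theorem truncatedUnitary_eq_exp (n : L → QuasiLocal ι) (χ : ℝ → ℝ) (a : Fin d → ℕ) (s : ℝ)
    (m : ℕ) : truncatedUnitary n χ a s m
      = NormedSpace.exp (s • (Complex.I • truncatedMoment n χ a m)) := by
  rw [← Complex.coe_smul, ← mul_smul, mul_comm]
  rfl

/-- The truncated moment is a finite sum over a box. -/
theorem IsCutoff.exists_finsum_eq {χ : ℝ → ℝ} (hχ : IsCutoff χ)
    (hL : HasEffectiveDimension L γ) (n : L → QuasiLocal ι) (a : Fin d → ℕ) {m : ℕ} (hm : 1 ≤ m) :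
    ∃ F : Finset L, (∀ x ∈ F, ∀ j, |(x : EuclideanSpace ℝ (Fin d)) j| ≤ 2 * m) ∧
      (∀ x ∉ F, truncatedMonomial χ a m x = 0) ∧
      truncatedMoment n χ a m = ∑ x ∈ F, (truncatedMonomial χ a m x : ℂ) • n x := by
  obtain ⟨C, -, hbox⟩ := hL.exists_box
  have hm1 : (1 : ℝ) ≤ m := by exact_mod_cast hm
  obtain ⟨F, hF, -⟩ := hbox (2 * m) (by linarith)
  have h0 : ∀ x ∉ F, truncatedMonomial χ a m x = 0 := by
    intro x hx
    rw [hF, not_forall] at hx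
    obtain ⟨j, hj⟩ := hx
    rw [truncatedMonomial, hχ.boxCutoff_eq_zero hm (not_le.1 hj).le, zero_mul]
  refine ⟨F, fun x hx => (hF x).1 hx, h0, finsum_eq_sum_of_support_subset _ fun x hx => ?_⟩
  by_contra hxF
  exact hx (by simp only [h0 x hxF, Complex.ofReal_zero, zero_smul])

/-- The balance of powers of `m`: the number of relevant points against the square of the Taylor
remainder. -/
theorem rpow_mul_sq_le_one {γ : ℝ} {k A : ℕ} (hA : A ≤ k) (hγ : γ ≤ 2 * ((k : ℝ) - A + 1))
    {m : ℕ} (hm : 1 ≤ m) : (m : ℝ) ^ γ * ((m : ℝ) ^ A / (m : ℝ) ^ (k + 1)) ^ 2 ≤ 1 := by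
  have hm1 : (1 : ℝ) ≤ m := by exact_mod_cast hm
  have hm0 : (0 : ℝ) < m := by linarith
  have h1 : (m : ℝ) ^ γ ≤ ((m : ℝ) ^ (k + 1 - A)) ^ 2 := by
    refine (Real.rpow_le_rpow_of_exponent_le hm1 hγ).trans (le_of_eq ?_)
    rw [← pow_mul, ← Real.rpow_natCast]
    congr 1
    rw [Nat.cast_mul, Nat.cast_sub (by omega)]
    push_cast
    ring
  have h2 : (m : ℝ) ^ (k + 1 - A) * ((m : ℝ) ^ A / (m : ℝ) ^ (k + 1)) = 1 := by
    rw [← mul_div_assoc, ← pow_add, show k + 1 - A + A = k + 1 by omega, div_self (by positivity)]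
  calc _ ≤ ((m : ℝ) ^ (k + 1 - A)) ^ 2 * ((m : ℝ) ^ A / (m : ℝ) ^ (k + 1)) ^ 2 := by gcongr
    _ = 1 := by rw [← mul_pow, h2, one_pow]

open scoped Classical in
theorem sum_le_card_mul_of_forall_mem {S : Type*} {G : Finset S} {E : Region S → ℝ} {c : ℝ}
    (hE : ∀ Z, 0 ≤ E Z) (hzero : ∀ Z : Region S, Disjoint Z.1 G → E Z = 0) (R : Finset (Region S))
    (hG : ∀ y ∈ G, ∑ Z ∈ R with y ∈ Z.1, E Z ≤ c) : ∑ Z ∈ R, E Z ≤ G.card * c := by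
  have hsplit : ∑ Z ∈ R, E Z = ∑ Z ∈ R with ¬ Disjoint Z.1 G, E Z := by
    rw [Finset.sum_filter]
    refine Finset.sum_congr rfl fun Z _ => ?_
    by_cases h : Disjoint Z.1 G
    · rw [if_neg (not_not.2 h), hzero Z h]
    · rw [if_pos h]
  rw [hsplit]
  refine (sum_meeting_le R hE).trans ((Finset.sum_le_sum hG).trans (le_of_eq ?_))
  rw [Finset.sum_const, nsmul_eq_mul]

/-- The norm of the second difference of the term `i φ(Z)` along the flow of `K`. -/
noncomputable def secondDifference (φ : Region L → QuasiLocal ι) (K : QuasiLocal ι) (s : ℝ)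
    (Z : Region L) : ℝ :=
  ‖flow K s (Complex.I • φ Z) + flow K (-s) (Complex.I • φ Z) - (2 : ℝ) • (Complex.I • φ Z)‖

theorem secondDifference_eq_zero {φ : Region L → QuasiLocal ι} {Q : QuasiLocal ι} {Z : Region L}
    (h : Commute Q (φ Z)) (s : ℝ) : secondDifference φ (Complex.I • Q) s Z = 0 := by
  have hc := (h.smul_left Complex.I).smul_right Complex.I
  rw [secondDifference, flow_of_commute hc, flow_of_commute hc, two_smul, sub_self, norm_zero]

variable [∀ x, Nonempty (ι x)]

/-- Charges sitting in the box of size `r` are supported in the box of size `r + R₀`, so they miss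
any region disjoint from the latter. -/
theorem commute_sum_charges_of_disjoint {n : L → QuasiLocal ι}
    {φ : Region L → QuasiLocal ι} (hφ : IsInteraction φ) {R₀ r : ℝ}
    (hsupp : ∀ x, operatorSupport (n x) ⊆ Metric.ball x R₀) {F G : Finset L}
    (hF : ∀ x ∈ F, ∀ j, |(x : EuclideanSpace ℝ (Fin d)) j| ≤ r)
    (hG : ∀ y : L, (∀ j, |(y : EuclideanSpace ℝ (Fin d)) j| ≤ r + R₀) → y ∈ G)
    {Z : Region L} (hZ : Disjoint Z.1 G) (f : L → ℝ) :
    Commute (∑ x ∈ F, (f x : ℂ) • n x) (φ Z) := by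
  refine commute_sum_charges_of_forall_notMem hφ f fun x hx hxZ => ?_
  obtain ⟨y, hy, hyZ⟩ := hxZ
  refine Finset.disjoint_left.1 hZ hyZ (hG y fun j => ?_)
  have h1 := abs_coord_le_norm ((y : EuclideanSpace ℝ (Fin d))
    - (x : EuclideanSpace ℝ (Fin d))) j
  have h2 : dist y x < R₀ := hsupp x hy
  rw [Subtype.dist_eq, dist_eq_norm] at h2
  rw [PiLp.sub_apply] at h1
  have h3 := abs_sub_abs_le_abs_sub ((y : EuclideanSpace ℝ (Fin d)) j)
    ((x : EuclideanSpace ℝ (Fin d)) j)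
  have h4 := hF x hx j
  linarith

theorem secondDifference_le {n : L → QuasiLocal ι} (hn : IsChargeFamily n)
    {φ : Region L → QuasiLocal ι} (hφ : IsInteraction φ)
    (hfin : ∀ Λ : Finset L, (chargesMeeting n Λ).Finite) {J : Finset (Fin d)} {k : ℕ}
    (hinv : ∀ b : Fin d → ℕ, ∑ j, b j ≤ k → (∀ j ∉ J, b j = 0) → IsMultipoleInvariant n φ b)
    {F : Finset L} {f : L → ℝ} (hf : ∀ x ∉ F, f x = 0) {N₀ : ℝ} (hN : ∀ x, ‖n x‖ ≤ N₀)
    (hN₀ : 0 ≤ N₀) {P : EuclideanSpace ℝ (Fin d) → ℝ} (hP : P ∈ polynomialsBelow J (k + 1))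
    {c : ℝ} {y : L} (hPf : ∀ z : L, |f z - P z| ≤ c * dist z y ^ (k + 1)) (s : ℝ) (Z : Region L) :
    secondDifference φ (Complex.I • ∑ x ∈ F, (f x : ℂ) • n x) s Z ≤ 8 * s ^ 2 * N₀ ^ 2 * c ^ 2 *
      (‖φ Z‖ * (∑ z ∈ (hfin Z.1).toFinset, dist z y ^ (k + 1)) ^ 2) := by
  refine (norm_second_difference_le hn hφ hfin (P := fun x => P x) hf
    (commute_polynomial_moment hfin hinv Z hP) hN s).trans ?_
  have h2 : ∑ z ∈ (hfin Z.1).toFinset, |f z - P z|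
      ≤ c * ∑ z ∈ (hfin Z.1).toFinset, dist z y ^ (k + 1) := by
    rw [Finset.mul_sum]
    exact Finset.sum_le_sum fun z _ => hPf z
  calc _ ≤ 8 * s ^ 2 * (N₀ * (c * ∑ z ∈ (hfin Z.1).toFinset, dist z y ^ (k + 1))) ^ 2
        * ‖φ Z‖ := by gcongr
    _ = _ := by ring

theorem exists_sum_secondDifference_le (hL : HasEffectiveDimension L γ) {n : L → QuasiLocal ι}
    (hn : IsChargeFamily n) {φ : Region L → QuasiLocal ι} (hφ : IsInteraction φ) {k : ℕ}
    (hmoment : MomentDecay n φ k) {χ : ℝ → ℝ} (hχ : IsCutoff χ) {J : Finset (Fin d)} {m₁ : ℕ}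
    (hJ : ∀ x ∈ L, ∀ j ∉ J, |x j| ≤ m₁)
    (hinv : ∀ b : Fin d → ℕ, ∑ j, b j ≤ k → (∀ j ∉ J, b j = 0) → IsMultipoleInvariant n φ b)
    {a : Fin d → ℕ} (ha : ∑ j, a j ≤ k) (haJ : ∀ j ∉ J, a j = 0)
    (hγ : γ ≤ 2 * ((k : ℝ) - (∑ j, a j : ℕ) + 1)) (s : ℝ) :
    ∃ C : ℝ, 0 ≤ C ∧ ∀ m : ℕ, 1 ≤ m → m₁ ≤ m → ∀ R : Finset (Region L),
      ∑ Z ∈ R, secondDifference φ (Complex.I • truncatedMoment n χ a m) s Z ≤ C := by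
  classical
  have hfin := hn.finite_chargesMeeting hL
  obtain ⟨K, hK0, hK⟩ := hmoment.exists_sum_le hfin
  obtain ⟨T, hT0, hT⟩ := hχ.exists_taylor haJ (k + 1)
  obtain ⟨D, hD0, hD⟩ := hL.exists_box
  obtain ⟨N₀, hN₀, hN⟩ := hn.bounded
  obtain ⟨R₀, hR₀, hsupp⟩ := hn.finiteRange
  have hγ0 := hL.pos
  refine ⟨D * (2 + R₀) ^ γ * (8 * s ^ 2 * N₀ ^ 2 * T ^ 2 * K), by positivity,
    fun m hm hm₁ R => ?_⟩
  have hm1 : (1 : ℝ) ≤ m := Nat.one_le_cast.2 hm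
  have hm0 : (0 : ℝ) < m := by linarith
  obtain ⟨F, hFbox, hF0, hFsum⟩ := hχ.exists_finsum_eq hL n a hm
  set q : ℝ := (m : ℝ) ^ (∑ j, a j) / (m : ℝ) ^ (k + 1) with hq
  -- The cut-off vanishes beyond `2m` and charges reach a distance `R₀`, so only regions meeting
  -- this box contribute.
  obtain ⟨G, hG, hGcard⟩ := hD (2 * m + R₀) (by linarith)
  have hsum : ∑ Z ∈ R, secondDifference φ (Complex.I • truncatedMoment n χ a m) s Z
      ≤ G.card * (8 * s ^ 2 * N₀ ^ 2 * (T * q) ^ 2 * K) := by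
    refine sum_le_card_mul_of_forall_mem (fun Z => norm_nonneg _) (fun Z hZ => ?_) R
      fun y _ => ?_
    · rw [hFsum]
      exact secondDifference_eq_zero (commute_sum_charges_of_disjoint hφ hsupp hFbox
        (fun y => (hG y).2) hZ _) s
    -- The Taylor polynomial is based at the point `y` through which the regions are summed, and so
    -- changes with `y`; moment decay then controls the sum over `Z ∋ y`.
    · obtain ⟨P, hP, hPx⟩ := hT m hm y
      have hPf : ∀ z : L, |truncatedMonomial χ a m z - P z| ≤ T * q * dist z y ^ (k + 1) := by
        intro z
        rw [Subtype.dist_eq, dist_eq_norm]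
        -- For `m ≥ m₁` the points of `L` satisfy `|x_j / m| ≤ 1` in the directions outside `J`, so
        -- those cut-offs equal one.
        refine hPx z fun j hj => hχ.eq_one _ ?_
        rw [abs_div, abs_of_pos hm0, div_le_one hm0]
        exact (hJ z z.2 j hj).trans (Nat.cast_le.2 hm₁)
      rw [hFsum]
      refine (Finset.sum_le_sum fun Z _ =>
        secondDifference_le hn hφ hfin hinv hF0 hN hN₀.le hP hPf s Z).trans ?_
      rw [← Finset.mul_sum]
      refine mul_le_mul_of_nonneg_left ?_ (by positivity)
      refine le_of_eq_of_le (Finset.sum_congr ?_ fun _ _ => rfl) (hK y R)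
      ext Z
      simp only [Finset.mem_filter]
  have hcard : (G.card : ℝ) ≤ D * ((2 + R₀) ^ γ * (m : ℝ) ^ γ) := by
    refine hGcard.trans ?_
    rw [← Real.mul_rpow (by positivity) hm0.le]
    refine mul_le_mul_of_nonneg_left (Real.rpow_le_rpow (by positivity) ?_ hγ0.le) hD0
    nlinarith
  refine hsum.trans ?_
  calc (G.card : ℝ) * (8 * s ^ 2 * N₀ ^ 2 * (T * q) ^ 2 * K)
      ≤ D * ((2 + R₀) ^ γ * (m : ℝ) ^ γ) * (8 * s ^ 2 * N₀ ^ 2 * (T * q) ^ 2 * K) :=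
        mul_le_mul_of_nonneg_right hcard (by positivity)
    _ = D * (2 + R₀) ^ γ * (8 * s ^ 2 * N₀ ^ 2 * T ^ 2 * K) * ((m : ℝ) ^ γ * q ^ 2) := by ring
    _ ≤ D * (2 + R₀) ^ γ * (8 * s ^ 2 * N₀ ^ 2 * T ^ 2 * K) * 1 :=
        mul_le_mul_of_nonneg_left (rpow_mul_sq_le_one ha hγ hm) (by positivity)
    _ = _ := mul_one _

theorem merminWagnerBound_truncatedUnitary (hL : HasEffectiveDimension L γ)
    {n : L → QuasiLocal ι} (hn : IsChargeFamily n) {φ : Region L → QuasiLocal ι}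
    (hφ : IsInteraction φ) {k : ℕ} (hmoment : MomentDecay n φ k) {κ : ℝ}
    (h : IsShortRange (fun Z => Complex.I • φ Z) κ)
    (hd : Dense (localizedElements fun Z => Complex.I • φ Z))
    {χ : ℝ → ℝ} (hχ : IsCutoff χ) {J : Finset (Fin d)} {m₁ : ℕ}
    (hJ : ∀ x ∈ L, ∀ j ∉ J, |x j| ≤ m₁)
    (hinv : ∀ b : Fin d → ℕ, ∑ j, b j ≤ k → (∀ j ∉ J, b j = 0) → IsMultipoleInvariant n φ b)
    {a : Fin d → ℕ} (ha : ∑ j, a j ≤ k) (haJ : ∀ j ∉ J, a j = 0)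
    (hγ : γ ≤ 2 * ((k : ℝ) - (∑ j, a j : ℕ) + 1)) (s : ℝ) :
    MerminWagnerBound (h.automorphism hd) (truncatedUnitary n χ a s) := by
  have hskew : ∀ m, 1 ≤ m →
      star (Complex.I • truncatedMoment n χ a m) = -(Complex.I • truncatedMoment n χ a m) := by
    intro m hm
    obtain ⟨F, -, -, hF⟩ := hχ.exists_finsum_eq hL n a hm
    rw [hF]
    exact hn.star_sum F _
  have hloc : ∀ m, 1 ≤ m → ∃ X, InRegion (truncatedUnitary n χ a s m) X ∧
      InRegion (star (truncatedUnitary n χ a s m)) X := by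
    intro m hm
    obtain ⟨F, -, -, hF⟩ := hχ.exists_finsum_eq hL n a hm
    obtain ⟨X, hX⟩ := hn.exists_inRegion_sum F (truncatedMonomial χ a m)
    have hUX : InRegion (truncatedUnitary n χ a s m) X := by
      rw [truncatedUnitary_eq_exp, hF, ← Complex.coe_smul, ← mul_smul]
      exact InRegion.exp ((regionAlgebra ι X).toSubalgebra.smul_mem hX _)
    exact ⟨X, hUX, star_mem (S := StarSubalgebra ℂ _) hUX⟩
  have hder : ∀ {A : QuasiLocal ι} {X : Finset L}, InRegion A X →
      HasDerivAt (fun t => h.automorphism hd t A)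
        (∑' Z : Region L, (Complex.I • φ Z * A - A * Complex.I • φ Z)) 0 :=
    fun hA => h.hasDerivAt_limitFlow hd (hφ.localizedIn hA)
  refine ⟨fun m hm => ?_, ?_⟩
  · obtain ⟨X, h1, h2⟩ := hloc m hm
    exact ⟨(hder h1).differentiableAt, (hder h2).differentiableAt⟩
  obtain ⟨C, hC0, hC⟩ := exists_sum_secondDifference_le hL hn hφ hmoment hχ hJ hinv ha haJ hγ s
  set v : ℕ → QuasiLocal ι := fun m =>
    truncatedUnitary n χ a s m * generator (h.automorphism hd) (star (truncatedUnitary n χ a s m))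
    + star (truncatedUnitary n χ a s m) * generator (h.automorphism hd) (truncatedUnitary n χ a s m)
    with hv
  -- The finitely many indices below `m₁` are bounded by their own norms.
  refine ⟨C + ∑ m ∈ Finset.range m₁, ‖v m‖, fun m hm => ?_⟩
  change ‖v m‖ ≤ _
  rcases lt_or_ge m m₁ with hlt | hge
  · have := Finset.single_le_sum (f := fun m => ‖v m‖) (fun m _ => norm_nonneg _)
      (Finset.mem_range.2 hlt)
    linarith
  · have h1 : ‖v m‖ ≤ C := by
      obtain ⟨X, hX, hX'⟩ := hloc m hm
      simp only [hv, generator]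
      rw [(hder hX).deriv, (hder hX').deriv]
      have l1 := hφ.localizedIn hX
      have l2 := hφ.localizedIn hX'
      rw [truncatedUnitary_eq_exp] at l1 l2 ⊢
      exact h.norm_generator_le (hskew m hm) s l1 l2 (hC m hm hge)
    have : 0 ≤ ∑ m ∈ Finset.range m₁, ‖v m‖ := Finset.sum_nonneg fun _ _ => norm_nonneg _
    linarith

end MerminWagner

theorem mainTheorem3 {d : ℕ} (L : Set (EuclideanSpace ℝ (Fin d))) (γ : ℝ)
    (hL : HasEffectiveDimension L γ)
    (ι : L → Type*) [∀ x, Finite (ι x)] [∀ x, Nonempty (ι x)]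
    (n : L → QuasiLocal ι) (hn : IsChargeFamily n)
    (φ : Region L → QuasiLocal ι) (hφ : IsInteraction φ) (k : ℕ)
    (hmoment : MomentDecay n φ k) (hpair : PairDecay φ γ)
    (χ : ℝ → ℝ) (hχ : IsCutoff χ) :
    ∃ α : ℝ → (QuasiLocal ι ≃⋆ₐ[ℂ] QuasiLocal ι),
      IsTimeEvolution α ∧ IsInducedBy α φ ∧
      -- invariance under all multipole symmetries of order at most `k`
      ((∀ a : Fin d → ℕ, ∑ j, a j ≤ k → IsMultipoleInvariant n φ a) →
        ∀ a : Fin d → ℕ, ∑ j, a j ≤ k → γ ≤ 2 * ((k : ℝ) - (∑ j, a j : ℕ) + 1) →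
          ∀ s : ℝ, MerminWagnerBound α (truncatedUnitary n χ a s)) ∧
      -- `L` is bounded in the directions `I`, and only the symmetries in `T_k` are assumed
      (∀ (I : Set (Fin d)) (M : Fin d → ℝ), (∀ j ∈ I, 0 ≤ M j) →
        (∀ x ∈ L, ∀ j ∈ I, |x j| ≤ M j) →
        (∀ a : Fin d → ℕ, ∑ j, a j ≤ k → (∀ j ∈ I, a j = 0) → IsMultipoleInvariant n φ a) →
        ∀ a : Fin d → ℕ, ∑ j, a j ≤ k → (∀ j ∈ I, a j = 0) →
          γ ≤ 2 * ((k : ℝ) - (∑ j, a j : ℕ) + 1) →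
          ∀ s : ℝ, MerminWagnerBound α (truncatedUnitary n χ a s)) := by
  obtain ⟨κ, hκ⟩ := hpair.exists_sum_le hL
  have h := hφ.isShortRange fun x R => by
    refine le_of_eq_of_le (Finset.sum_congr ?_ fun _ _ => rfl) (hκ x R)
    ext Z
    simp only [Finset.mem_filter]
  have hd := hφ.dense_localizedElements
  refine ⟨h.automorphism hd, h.isTimeEvolution hd, h.isInducedBy hd, ?_, ?_⟩
  · intro hinv a ha hγ s
    -- No direction is treated as bounded, so no lower threshold on `m` is needed.
    exact merminWagnerBound_truncatedUnitary hL hn hφ hmoment h hd hχ (J := Finset.univ) (m₁ := 0)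
      (fun x _ j hj => absurd (Finset.mem_univ j) hj) (fun b hb _ => hinv b hb) ha
      (fun j hj => absurd (Finset.mem_univ j) hj) hγ s
  · classical
    intro I M _ hLM hinv a ha haI hγ s
    -- An integer above every `M j`, beyond which the cut-offs in the directions `I` are invisible
    -- on `L`.
    obtain ⟨m₁, hm₁⟩ := Finite.exists_le fun j => ⌈M j⌉₊
    have hI : ∀ j, j ∉ Finset.univ.filter (fun j => j ∉ I) ↔ j ∈ I := by simp
    refine merminWagnerBound_truncatedUnitary hL hn hφ hmoment h hd hχ
      (J := Finset.univ.filter fun j => j ∉ I) (m₁ := m₁) (fun x hx j hj => ?_)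
      (fun b hb hbJ => hinv b hb fun j hj => hbJ j ((hI j).2 hj)) ha
      (fun j hj => haI j ((hI j).1 hj)) hγ s
    exact (hLM x hx j ((hI j).1 hj)).trans ((Nat.le_ceil _).trans (by exact_mod_cast hm₁ j))
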